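/- Let $K\subset\mathbb{R}^d$ ($d\ge 1$) be a convex body (compact, convex, with nonempty interior) with diameter $D(K)$, and let $\psi(z)=\frac{d}{dz}\mathbb{P}(\|P_1-P_2\|\le z)$ be the density of the distance between two independent points $P_1,P_2$ uniformly distributed in $K$. Let $Z=\{Z(x,t):x\in\mathbb{R}^d,\ t\in\mathbb{R}\}$ be a (jointly) measurable, mean-square continuous real Gaussian random field, homogeneous and isotropic in space and stationary in time, with $\mathbb{E}[Z(x,t)]=0$, $\mathbb{E}[Z(x,t)^2]=1$ and nonnegative covariance function $$\mathbb{E}[Z(x,t)Z(y,s)]=C(\|x-y\|,|t-s|)\ge 0 .$$ Let $\phi$ be the standard normal density, let $H_q$ be the (probabilists') Hermite polynomials, $\frac{d^q\phi}{dz^q}=(-1)^qH_q\phi$, and let $G:\mathbb{R}\to\mathbb{R}$ be Borel measurable with $\int_{\mathbb{R}} G(z)^2\phi(z)\,dz<\infty$ and with Hermite coefficients $G_q=\int_{\mathbb{R}}H_q(\xi)G(\xi)\phi(\xi)\,d\xi$. Assume that $G$ has Hermite rank $m\ge 1$, i.e. $G_q=0$ for $1\le q<m$ and $G_m\ne 0$.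 Assume moreover that (i) $\sup_{z\in[0,D(K)]}|C(z,\tau)|\to 0$ as $\tau\to\infty$; (ii) there exists $\delta\in(0,1)$ such that $$\lim_{T\to\infty}\frac{1}{T^{\delta}}\int_0^T\Big(1-\frac{\tau}{T}\Big)\int_0^{D(K)}C(z,\tau)^m\,\psi(z)\,dz\,d\tau=\infty .$$ For $T>0$ put $$A_T=\int_0^T\!\!\int_K G(Z(x,t))\,dx\,dt,\qquad \eta_{m,T}=\int_0^T\!\!\int_K H_m(Z(x,t))\,dx\,dt,\qquad \sigma_{m,K}(T)=\big(\mathbb{E}[\eta_{m,T}^2]\big)^{1/2},$$ $$Y_T=\frac{A_T-\mathbb{E}[A_T]}{|G_m|\,\sigma_{m,K}(T)/m!},\qquad Y_{m,T}=\frac{\operatorname{sgn}(G_m)\,\eta_{m,T}}{\sigma_{m,K}(T)} .$$ Then these quantities are well defined: for every $T>0$, almost surely $G(Z(x,t))$ is integrable over $(x,t)\in K\times[0,T]$, and $A_T$ is square integrable; and $\sigma_{m,K}(T)>0$ for all sufficiently large $T$. Moreover $$\mathbb{E}\big[(Y_T-Y_{m,T})^2\big]\to 0\qquad (T\to\infty),$$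 and $Y_T$ and $Y_{m,T}$ have the same limiting distribution as $T\to\infty$, if either one exists: for every probability measure $\nu$ on $\mathbb{R}$, $Y_T$ converges in distribution to $\nu$ if and only if $Y_{m,T}$ does. -/

import Mathlib

open MeasureTheory ProbabilityTheory Filter Set
open scoped Topology Nat

/-- The probabilists' Hermite polynomial `H_q`, as a real function. -/
noncomputable def hermiteFun (q : ℕ) (x : ℝ) : ℝ :=
  Polynomial.aeval x (Polynomial.hermite q)

/-- The Hermite coefficient `G_q = ∫ H_q(ξ) G(ξ) φ(ξ) dξ`, where `φ` is the standard Gaussian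
density. -/
noncomputable def hermiteCoeff (G : ℝ → ℝ) (q : ℕ) : ℝ :=
  ∫ ξ, hermiteFun q ξ * G ξ ∂(gaussianReal 0 1)

/-- `m ≥ 1` is the Hermite rank of `G`: the first positive index with a nonzero coefficient. -/
structure HasHermiteRank (G : ℝ → ℝ) (m : ℕ) : Prop where
  one_le : 1 ≤ m
  coeff_eq_zero : ∀ q, 1 ≤ q → q < m → hermiteCoeff G q = 0
  coeff_ne_zero : hermiteCoeff G m ≠ 0

/-- `Z` is a jointly measurable, mean-square continuous, centred Gaussian random field on
`ℝ^d × ℝ` with unit variance, whose covariance is nonnegative and equal to `C(‖x - y‖, |t - s|)`.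
For a centred Gaussian field, this form of the covariance is homogeneity and isotropy in space
together with stationarity in time. -/
structure IsIsotropicStationaryGaussianField {d : ℕ} {Ω : Type*} [MeasurableSpace Ω]
    (Z : EuclideanSpace ℝ (Fin d) → ℝ → Ω → ℝ) (C : ℝ → ℝ → ℝ) (P : Measure Ω) : Prop where
  measurable : Measurable
    (fun q : (EuclideanSpace ℝ (Fin d) × ℝ) × Ω => Z q.1.1 q.1.2 q.2)
  gaussian : IsGaussianProcess
    (fun (p : EuclideanSpace ℝ (Fin d) × ℝ) (ω : Ω) => Z p.1 p.2 ω) P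
  mean_square_continuous : ∀ (x₀ : EuclideanSpace ℝ (Fin d)) (t₀ : ℝ),
    Tendsto (fun p : EuclideanSpace ℝ (Fin d) × ℝ =>
      ∫ ω, (Z p.1 p.2 ω - Z x₀ t₀ ω) ^ 2 ∂P) (𝓝 (x₀, t₀)) (𝓝 0)
  mean_zero : ∀ x t, ∫ ω, Z x t ω ∂P = 0
  unit_variance : ∀ x t, ∫ ω, Z x t ω ^ 2 ∂P = 1
  covariance : ∀ x y t s, ∫ ω, Z x t ω * Z y s ω ∂P = C ‖x - y‖ |t - s|
  covariance_nonneg : ∀ x y t s, 0 ≤ ∫ ω, Z x t ω * Z y s ω ∂P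

/-- The law of `ρ_K = ‖P₁ - P₂‖` for two independent uniformly distributed points of `K`. -/
noncomputable def pairDistanceLaw {d : ℕ} (K : Set (EuclideanSpace ℝ (Fin d))) : Measure ℝ :=
  ((cond volume K).prod (cond volume K)).map (fun p => ‖p.1 - p.2‖)

/-- The probability density `ψ(z) = d/dz P(ρ_K ≤ z)` of `ρ_K`. -/
noncomputable def pairDistanceDensity {d : ℕ} (K : Set (EuclideanSpace ℝ (Fin d))) (z : ℝ) : ℝ :=
  deriv (fun r => (pairDistanceLaw K).real (Iic r)) z

/-- The supremum of `|C(z, τ)|` over `z ∈ [0, diam K]` tends to `0` as `τ → ∞`. -/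
def CovarianceVanishes {d : ℕ} (K : Set (EuclideanSpace ℝ (Fin d))) (C : ℝ → ℝ → ℝ) : Prop :=
  Tendsto (fun τ : ℝ => ⨆ z : Icc (0 : ℝ) (Metric.diam K), |C z τ|) atTop (𝓝 0)

/-- For some `δ ∈ (0,1)`,
`T^{-δ} ∫_0^T (1 - τ/T) ∫_0^{diam K} C(z,τ)^m ψ(z) dz dτ → ∞` as `T → ∞`. -/
def PowerIntegralDiverges {d : ℕ} (K : Set (EuclideanSpace ℝ (Fin d))) (C : ℝ → ℝ → ℝ)
    (m : ℕ) : Prop :=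
  ∃ δ : ℝ, 0 < δ ∧ δ < 1 ∧
    Tendsto (fun T : ℝ => (1 / T ^ δ) *
      ∫ τ in (0 : ℝ)..T, (1 - τ / T) *
        ∫ z in (0 : ℝ)..(Metric.diam K), C z τ ^ m * pairDistanceDensity K z) atTop atTop

/-- The local functional `A_T = ∫_0^T ∫_K G(Z(x,t)) dx dt`. -/
noncomputable def localFunctional {d : ℕ} {Ω : Type*}
    (K : Set (EuclideanSpace ℝ (Fin d))) (Z : EuclideanSpace ℝ (Fin d) → ℝ → Ω → ℝ)
    (G : ℝ → ℝ) (T : ℝ) (ω : Ω) : ℝ :=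
  ∫ t in (0 : ℝ)..T, ∫ x in K, G (Z x t ω)

/-- `σ_{n,K}(T) = (E[η_n²])^{1/2}`, with `η_n = ∫_0^T ∫_K H_n(Z(x,t)) dx dt`. -/
noncomputable def hermiteSigma {d : ℕ} {Ω : Type*} [MeasurableSpace Ω]
    (K : Set (EuclideanSpace ℝ (Fin d))) (Z : EuclideanSpace ℝ (Fin d) → ℝ → Ω → ℝ)
    (P : Measure Ω) (n : ℕ) (T : ℝ) : ℝ :=
  √(∫ ω, localFunctional K Z (hermiteFun n) T ω ^ 2 ∂P)

/-- `Y_T = (A_T - E[A_T]) / (|G_m| σ_{m,K}(T) (1/m!))`. -/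
noncomputable def normalizedFunctional {d : ℕ} {Ω : Type*} [MeasurableSpace Ω]
    (K : Set (EuclideanSpace ℝ (Fin d))) (Z : EuclideanSpace ℝ (Fin d) → ℝ → Ω → ℝ)
    (P : Measure Ω) (G : ℝ → ℝ) (m : ℕ) (T : ℝ) (ω : Ω) : ℝ :=
  (localFunctional K Z G T ω - ∫ ω', localFunctional K Z G T ω' ∂P) /
    (|hermiteCoeff G m| * hermiteSigma K Z P m T * (1 / (m ! : ℝ)))

/-- `Y_{m,T} = sgn(G_m) ∫_0^T ∫_K H_m(Z(x,t)) dx dt / σ_{m,K}(T)`. -/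
noncomputable def normalizedHermiteFunctional {d : ℕ} {Ω : Type*} [MeasurableSpace Ω]
    (K : Set (EuclideanSpace ℝ (Fin d))) (Z : EuclideanSpace ℝ (Fin d) → ℝ → Ω → ℝ)
    (P : Measure Ω) (G : ℝ → ℝ) (m : ℕ) (T : ℝ) (ω : Ω) : ℝ :=
  Real.sign (hermiteCoeff G m) * localFunctional K Z (hermiteFun m) T ω / hermiteSigma K Z P m T

/-! ### Hermite polynomials in `L²` of the Gaussian measure -/

section GaussianPolynomials

open Polynomial
open scoped NNReal ENNReal

/-! Split `G = G_0 + (G_m / m!) H_m + R`. By the rank condition `R` has no Hermite components of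
order at most `m`, and `Y_T - Y_{m,T}` is the local functional of `R` divided by the normalization
of `Y_T`. By Mehler's formula, a standard bivariate Gaussian pair with correlation `ρ ∈ [0,1]`
satisfies `E[R(X) R(Y)] ≤ ρ^(m+1) ‖R‖²`, while `E[H_m(X) H_m(Y)] = m! ρ^m`.

Write `I_n(T)` for the integral of `C^n` over pairs of space-time points
(`covariancePowerIntegral`). Integrating these covariances gives `σ_m² = m! I_m`, and the squared
`L²` distance is at most a constant times `I_{m+1} / I_m`. This ratio tends to zero: pairs with time
lag above some `τ₀` satisfy `C ≤ ε` by (i), and the remaining strip has measure `O(T)`, so `I_{m+1}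
≤ ε I_m + B T` (`covariancePowerIntegral_succ_le`). Hypothesis (ii) makes `I_m` grow faster than `T`
(`tendsto_covariancePowerIntegral_div`). The statement on limit laws is then Slutsky's theorem.

Mehler's formula (`hasSum_integral_mul_of_hasGaussianLaw`) rests on the Hermite polynomials being an
orthonormal basis after normalization and eigenfunctions of the Ornstein–Uhlenbeck semigroup. -/

lemma memLp_pow_gaussianReal (v : ℝ≥0) (n : ℕ) :
    MemLp (fun x : ℝ => x ^ n) 2 (gaussianReal 0 v) := by
  rw [memLp_two_iff_integrable_sq (by fun_prop)]
  have h := (memLp_id_gaussianReal (μ := 0) (v := v) ((n * 2 : ℕ) : ℝ≥0))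
  have h' : MemLp id ((n * 2 : ℕ) : ℝ≥0∞) (gaussianReal 0 v) := by simpa using h
  have := h'.integrable_norm_pow'
  refine this.congr (ae_of_all _ fun x => ?_)
  simp only [id, Real.norm_eq_abs]
  rw [pow_mul, ← abs_pow, sq_abs]

lemma memLp_eval_gaussianReal (v : ℝ≥0) (p : ℝ[X]) :
    MemLp (fun x : ℝ => p.eval x) 2 (gaussianReal 0 v) := by
  simp_rw [eval_eq_sum_range]
  exact memLp_finsetSum _ fun i _ => (memLp_pow_gaussianReal v i).const_mul _

lemma integrable_eval_gaussianReal (v : ℝ≥0) (p : ℝ[X]) :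
    Integrable (fun x : ℝ => p.eval x) (gaussianReal 0 v) :=
  (memLp_eval_gaussianReal v p).integrable one_le_two

lemma hasDerivAt_gaussianPDFReal (v : ℝ≥0) (x : ℝ) :
    HasDerivAt (gaussianPDFReal 0 v) (gaussianPDFReal 0 v x * (-x / v)) x := by
  have h : HasDerivAt (fun y : ℝ => (√(2 * Real.pi * v))⁻¹ * Real.exp (-(y - 0) ^ 2 / (2 * v)))
      ((√(2 * Real.pi * v))⁻¹ * (Real.exp (-(x - 0) ^ 2 / (2 * v)) *
        (-(2 * (x - 0)) / (2 * v)))) x := by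
    refine (HasDerivAt.exp ?_).const_mul _
    refine HasDerivAt.div_const ?_ _
    have := (((hasDerivAt_id x).sub_const 0).pow 2).neg
    simpa using! this
  have hfun : gaussianPDFReal 0 v =
      fun y : ℝ => (√(2 * Real.pi * v))⁻¹ * Real.exp (-(y - 0) ^ 2 / (2 * v)) := by
    ext y; simp [gaussianPDFReal]
  rw [hfun]
  convert h using 1
  rw [mul_assoc, sub_zero, ← mul_neg, mul_div_mul_left _ _ (two_ne_zero' ℝ)]

/-- Gaussian integration by parts for polynomials. -/
lemma integral_mul_eval_gaussianReal (v : ℝ≥0) (p : ℝ[X]) :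
    ∫ x, x * p.eval x ∂(gaussianReal 0 v) = v * ∫ x, p.derivative.eval x ∂(gaussianReal 0 v) := by
  -- Variance zero is the Dirac mass at the origin; it must be covered because it occurs for
  -- correlation `±1`.
  by_cases hv : v = 0
  · simp [hv, gaussianReal_zero_var]
  have hv' : (v : ℝ) ≠ 0 := by exact_mod_cast hv
  have hint : ∀ q : ℝ[X], Integrable (fun x => q.eval x * gaussianPDFReal 0 v x) := by
    intro q
    have h := integrable_eval_gaussianReal v q
    rw [gaussianReal_of_var_ne_zero _ hv,
      integrable_withDensity_iff (measurable_gaussianPDF 0 v)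
        (ae_of_all _ fun _ => gaussianPDF_lt_top)] at h
    simpa [toReal_gaussianPDF] using h
  have key := integral_mul_deriv_eq_deriv_mul_of_integrable
    (u := fun x => p.eval x) (u' := fun x => p.derivative.eval x)
    (v := gaussianPDFReal 0 v) (v' := fun x => gaussianPDFReal 0 v x * (-x / v))
    (fun x _ => p.hasDerivAt x) (fun x _ => hasDerivAt_gaussianPDFReal v x)
    (by
      refine (((hint (X * p)).const_mul (-(v : ℝ)⁻¹))).congr (ae_of_all _ fun x => ?_)
      simp only [eval_mul, eval_X, Pi.mul_apply]
      field_simp)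
    (hint _) (hint _)
  rw [integral_gaussianReal_eq_integral_smul hv, integral_gaussianReal_eq_integral_smul hv]
  simp only [smul_eq_mul]
  have h1 : ∫ x, p.eval x * (gaussianPDFReal 0 v x * (-x / v)) =
      -(v : ℝ)⁻¹ * ∫ x, gaussianPDFReal 0 v x * (x * p.eval x) := by
    rw [← integral_const_mul]
    congr 1; ext x; field_simp
  have h2 : ∫ x, p.derivative.eval x * gaussianPDFReal 0 v x =
      ∫ x, gaussianPDFReal 0 v x * p.derivative.eval x := by
    congr 1; ext x; ring
  rw [h1, h2] at key
  have key' := congrArg (fun r => -(v : ℝ) * r) key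
  simp only [← mul_assoc, neg_mul_neg, mul_inv_cancel₀ hv', one_mul] at key'
  simpa [mul_assoc] using key'

/-- The real Hermite polynomial. -/
noncomputable def hermiteReal (q : ℕ) : ℝ[X] := (hermite q).map (Int.castRingHom ℝ)

lemma hermiteFun_eq_eval (q : ℕ) (x : ℝ) : hermiteFun q x = (hermiteReal q).eval x := by
  simp [hermiteFun, hermiteReal, eval_map, aeval_def]

lemma hermiteReal_zero : hermiteReal 0 = 1 := by simp [hermiteReal]

/-- Appell property: differentiate `H_{n+1} = X H_n - H_n'` and induct. It turns that recursion into
the three-term one. -/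
lemma derivative_hermite_succ (n : ℕ) :
    derivative (hermite (n + 1)) = (n + 1 : ℤ[X]) * hermite n := by
  induction n with
  | zero => simp [hermite_succ]
  | succ n ih =>
    rw [hermite_succ (n + 1), derivative_sub, derivative_mul, derivative_X, ih, hermite_succ n]
    simp only [derivative_mul, derivative_add, derivative_natCast, derivative_one]
    push_cast
    ring

lemma derivative_hermiteReal_succ (n : ℕ) :
    derivative (hermiteReal (n + 1)) = C (n + 1 : ℝ) * hermiteReal n := by
  rw [hermiteReal, derivative_map, derivative_hermite_succ, hermiteReal]
  simp

lemma hermiteReal_succ (n : ℕ) :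
    hermiteReal (n + 1) = X * hermiteReal n - derivative (hermiteReal n) := by
  simp [hermiteReal, hermite_succ, derivative_map]

lemma hermiteReal_succ_succ (n : ℕ) :
    hermiteReal (n + 2) = X * hermiteReal (n + 1) - C (n + 1 : ℝ) * hermiteReal n := by
  rw [hermiteReal_succ, derivative_hermiteReal_succ]

/-- Hermite polynomials are eigenfunctions of the Ornstein–Uhlenbeck semigroup. -/
lemma integral_hermiteReal_add_gaussianReal (ρ : ℝ) (v : ℝ≥0) (hv : ρ ^ 2 + v = 1) (q : ℕ) (x : ℝ) :
    ∫ w, (hermiteReal q).eval (ρ * x + w) ∂(gaussianReal 0 v) = ρ ^ q * (hermiteReal q).eval x := by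
  have hint : ∀ p : ℝ[X], Integrable (fun w => p.eval (ρ * x + w)) (gaussianReal 0 v) := by
    intro p
    have h := integrable_eval_gaussianReal v (p.comp (C (ρ * x) + X))
    simpa only [eval_comp, eval_add, eval_C, eval_X] using h
  have hintw : ∀ p : ℝ[X], Integrable (fun w => w * p.eval (ρ * x + w)) (gaussianReal 0 v) := by
    intro p
    have h := integrable_eval_gaussianReal v (X * p.comp (C (ρ * x) + X))
    simpa only [eval_mul, eval_X, eval_comp, eval_add, eval_C] using h
  have stein : ∀ p : ℝ[X], ∫ w, w * p.eval (ρ * x + w) ∂(gaussianReal 0 v) =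
      v * ∫ w, p.derivative.eval (ρ * x + w) ∂(gaussianReal 0 v) := by
    intro p
    have h := integral_mul_eval_gaussianReal v (p.comp (C (ρ * x) + X))
    simpa only [derivative_comp, eval_mul, eval_X, eval_comp, eval_add, eval_C, derivative_add,
      derivative_C, derivative_X, zero_add, one_mul] using h
  -- The three-term recursion calls for two previous cases; its term `w * H_{n+1}` is removed by
  -- Gaussian integration by parts.
  induction q using Nat.twoStepInduction with
  | zero => simp [hermiteReal_zero]
  | one =>
    have h := stein 1
    simp only [eval_one, mul_one, derivative_one, eval_zero, integral_zero, mul_zero] at h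
    have h1 : Integrable (fun w : ℝ => w) (gaussianReal 0 v) := by simpa using hintw 1
    rw [hermiteReal_succ, hermiteReal_zero]
    simp only [derivative_one, mul_one, sub_zero, eval_X]
    rw [integral_add (integrable_const _) h1, h]
    simp
  | more n ih0 ih1 =>
    have hexp : ∀ w, (hermiteReal (n + 2)).eval (ρ * x + w) =
        (ρ * x * (hermiteReal (n + 1)).eval (ρ * x + w) +
          w * (hermiteReal (n + 1)).eval (ρ * x + w)) -
        (n + 1 : ℝ) * (hermiteReal n).eval (ρ * x + w) := by
      intro w
      rw [hermiteReal_succ_succ]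
      simp
      ring
    simp_rw [hexp]
    rw [integral_sub (((hint _).const_mul _).fun_add (hintw _)) ((hint _).const_mul _),
      integral_add ((hint _).const_mul _) (hintw _), integral_const_mul, integral_const_mul,
      stein, derivative_hermiteReal_succ, ih1, ih0]
    simp only [eval_mul, eval_C]
    rw [integral_const_mul, ih0, hermiteReal_succ_succ]
    simp only [eval_sub, eval_mul, eval_X, eval_C]
    -- The terms in `H_n` carry the factor `v - 1 = -ρ²`, so the recursion at `x` reappears with
    -- `ρ^(n+2)` in front.
    have : (v : ℝ) = 1 - ρ ^ 2 := by linarith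
    rw [this]
    ring

/-- The raising operator `X - d/dx` is adjoint to `d/dx`, so both indices can be lowered together.
The means, needed at the bottom, come from the eigenfunction identity with `ρ = 0`. -/
lemma integral_hermiteReal_mul_hermiteReal (p q : ℕ) :
    ∫ x, (hermiteReal p).eval x * (hermiteReal q).eval x ∂(gaussianReal 0 1) =
      if p = q then (q ! : ℝ) else 0 := by
  have hint (r : ℝ[X]) := integrable_eval_gaussianReal 1 r
  have hzero : ∀ q : ℕ, ∫ x, (hermiteReal q).eval x ∂(gaussianReal 0 1) =
      if 0 = q then (q ! : ℝ) else 0 := by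
    intro q
    have h := integral_hermiteReal_add_gaussianReal 0 1 (by simp) q 0
    simp only [mul_zero, zero_add] at h
    rw [h]
    rcases q with _ | q
    · simp [hermiteReal_zero]
    · simp
  have hrec : ∀ p q : ℕ,
      ∫ x, (hermiteReal (p + 1)).eval x * (hermiteReal q).eval x ∂(gaussianReal 0 1) =
      ∫ x, (hermiteReal p).eval x * (derivative (hermiteReal q)).eval x ∂(gaussianReal 0 1) := by
    intro p q
    have h := integral_mul_eval_gaussianReal 1 (hermiteReal p * hermiteReal q)
    simp only [NNReal.coe_one, one_mul, derivative_mul, eval_add] at h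
    rw [integral_add (hint _) (hint _)] at h
    have h2 : ∫ x, (hermiteReal (p + 1)).eval x * (hermiteReal q).eval x ∂(gaussianReal 0 1) =
        ∫ x, x * (hermiteReal p * hermiteReal q).eval x ∂(gaussianReal 0 1) -
        ∫ x, (derivative (hermiteReal p) * hermiteReal q).eval x ∂(gaussianReal 0 1) := by
      rw [← integral_sub _ (hint _)]
      · congr 1; ext x; rw [hermiteReal_succ]; simp; ring
      · have h' := hint (X * (hermiteReal p * hermiteReal q))
        simpa only [eval_mul, eval_X] using h'
    rw [h2, h]
    simp
  induction p generalizing q with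
  | zero => simpa [hermiteReal_zero] using hzero q
  | succ p ih =>
    rw [hrec]
    rcases q with _ | q
    · simp [hermiteReal_zero]
    · rw [derivative_hermiteReal_succ]
      simp only [eval_mul, eval_C]
      simp_rw [mul_left_comm]
      rw [integral_const_mul, ih]
      by_cases h : p = q
      · subst h; simp [Nat.factorial_succ]
      · simp [h]

lemma natDegree_hermiteReal (n : ℕ) : (hermiteReal n).natDegree = n := by
  rw [hermiteReal, (hermite_monic n).natDegree_map, natDegree_hermite]

lemma monic_hermiteReal (n : ℕ) : (hermiteReal n).Monic := (hermite_monic n).map _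

/-- A function orthogonal to all Hermite polynomials is orthogonal to all polynomials. -/
lemma integral_eval_mul_eq_zero {h : ℝ → ℝ} (hh : MemLp h 2 (gaussianReal 0 1))
    (hz : ∀ q, ∫ x, (hermiteReal q).eval x * h x ∂(gaussianReal 0 1) = 0) (p : ℝ[X]) :
    ∫ x, p.eval x * h x ∂(gaussianReal 0 1) = 0 := by
  have hint (r : ℝ[X]) : Integrable (fun x => r.eval x * h x) (gaussianReal 0 1) :=
    (memLp_eval_gaussianReal 1 r).integrable_mul hh
  suffices H : ∀ n : ℕ, ∀ p : ℝ[X], p.degree < n → ∫ x, p.eval x * h x ∂(gaussianReal 0 1) = 0 from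
    H (p.natDegree + 1) p (degree_le_natDegree.trans_lt (by exact_mod_cast Nat.lt_succ_self _))
  intro n
  induction n with
  | zero =>
    intro p hp
    have : p = 0 := by
      rw [← degree_eq_bot]
      simpa [Nat.WithBot.lt_zero_iff] using hp
    simp [this]
  | succ n ih =>
    intro p hp
    -- Since `H_n` is monic of degree `n`, this subtraction cancels the coefficient of degree `n`.
    have hr : (p - C (p.coeff n) * hermiteReal n).degree < n := by
      rw [degree_lt_iff_coeff_zero]
      intro k hk
      rcases hk.eq_or_lt with rfl | hk
      · have := (monic_hermiteReal n).coeff_natDegree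
        rw [natDegree_hermiteReal] at this
        simp [this]
      · have h1 : p.coeff k = 0 := coeff_eq_zero_of_degree_lt
          (lt_of_lt_of_le hp (by exact_mod_cast hk))
        have h2 : (hermiteReal n).coeff k = 0 :=
          coeff_eq_zero_of_natDegree_lt (by rwa [natDegree_hermiteReal])
        simp [h1, h2]
    have hsplit : ∀ x, p.eval x * h x = (p - C (p.coeff n) * hermiteReal n).eval x * h x +
        p.coeff n * ((hermiteReal n).eval x * h x) := by
      intro x; simp; ring
    simp_rw [hsplit]
    rw [integral_add (hint _) ((hint _).const_mul _), ih _ hr, integral_const_mul, hz]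
    simp

/-- Integrate the exponential series term by term. The dominating function `exp(|t||x|) |h x|` is
integrable as a product of two `L²` functions. -/
lemma integral_cexp_mul_eq_zero {h : ℝ → ℝ} (hh : MemLp h 2 (gaussianReal 0 1))
    (hz : ∀ n : ℕ, ∫ x, x ^ n * h x ∂(gaussianReal 0 1) = 0) (t : ℝ) :
    ∫ x, Complex.exp (t * x * Complex.I) * h x ∂(gaussianReal 0 1) = 0 := by
  have hexp : MemLp (fun x => Real.exp (|t| * |x|)) 2 (gaussianReal 0 1) := by
    rw [memLp_two_iff_integrable_sq (by fun_prop)]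
    refine ((integrable_exp_mul_gaussianReal (μ := 0) (v := 1) (2 * |t|)).add
      (integrable_exp_mul_gaussianReal (-(2 * |t|)))).mono' (by fun_prop) (ae_of_all _ fun x => ?_)
    rw [Real.norm_eq_abs, abs_of_nonneg (by positivity), ← Real.exp_nat_mul, Pi.add_apply]
    rcases abs_cases x with ⟨hx, _⟩ | ⟨hx, _⟩
    · rw [hx]
      refine le_add_of_le_of_nonneg (le_of_eq ?_) (Real.exp_pos _).le
      congr 1; push_cast; ring
    · rw [hx]
      refine le_add_of_nonneg_of_le (Real.exp_pos _).le (le_of_eq ?_)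
      congr 1; push_cast; ring
  have hs := hasSum_integral_of_dominated_convergence (μ := gaussianReal 0 1)
    (F := fun (n : ℕ) (x : ℝ) => ((t * x * Complex.I) ^ n / (n ! : ℂ)) * h x)
    (f := fun x => Complex.exp (t * x * Complex.I) * h x)
    (fun n x => (|t| * |x|) ^ n / (n ! : ℝ) * |h x|)
    (fun n => by
      refine AEStronglyMeasurable.mul (by fun_prop) ?_
      exact Complex.continuous_ofReal.comp_aestronglyMeasurable hh.1)
    (fun n => ae_of_all _ fun x => by
      simp [mul_pow])
    (ae_of_all _ fun x => (Real.summable_pow_div_factorial _).mul_right _)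
    (by
      simp_rw [tsum_mul_right]
      have : ∀ x : ℝ, ∑' n : ℕ, (|t| * |x|) ^ n / (n ! : ℝ) = Real.exp (|t| * |x|) := by
        intro x
        rw [Real.exp_eq_exp_ℝ, NormedSpace.exp_eq_tsum_div]
      simp_rw [this]
      exact hexp.integrable_mul hh.abs)
    (ae_of_all _ fun x => by
      refine HasSum.mul_right _ ?_
      rw [Complex.exp_eq_exp_ℂ]
      exact NormedSpace.expSeries_div_hasSum_exp _)
  have hterm : ∀ n : ℕ, ∫ x, ((t * x * Complex.I) ^ n / (n ! : ℂ)) * h x ∂(gaussianReal 0 1) = 0 := by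
    intro n
    have : ∀ x : ℝ, (((t : ℂ) * x * Complex.I) ^ n / (n ! : ℂ)) * h x =
        ((t * Complex.I) ^ n / (n ! : ℂ)) * ((x ^ n * h x : ℝ) : ℂ) := by
      intro x; push_cast; rw [mul_pow, mul_pow, mul_pow]; ring
    simp_rw [this]
    rw [integral_const_mul, integral_complex_ofReal, hz]
    simp
  simp_rw [hterm] at hs
  exact hs.unique hasSum_zero

/-- Completeness of the monomials in `L²` of the standard Gaussian measure. -/
lemma ae_eq_zero_of_integral_pow_mul_eq_zero {h : ℝ → ℝ} (hm : Measurable h)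
    (hh : MemLp h 2 (gaussianReal 0 1))
    (hz : ∀ n : ℕ, ∫ x, x ^ n * h x ∂(gaussianReal 0 1) = 0) :
    h =ᵐ[gaussianReal 0 1] 0 := by
  have hi : Integrable h (gaussianReal 0 1) := hh.integrable one_le_two
  have hm' : Measurable fun x => -h x := hm.neg
  have hfin : ∀ g : ℝ → ℝ, Integrable g (gaussianReal 0 1) →
      ∫⁻ x, ((g x).toNNReal : ℝ≥0∞) ∂(gaussianReal 0 1) ≠ ∞ := fun g hg => hg.lintegral_lt_top.ne
  have hf1 : IsFiniteMeasure ((gaussianReal 0 1).withDensity fun x => ((h x).toNNReal : ℝ≥0∞)) :=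
    isFiniteMeasure_withDensity (hfin h hi)
  have hf2 : IsFiniteMeasure
      ((gaussianReal 0 1).withDensity fun x => ((-h x).toNNReal : ℝ≥0∞)) :=
    isFiniteMeasure_withDensity (hfin _ hi.neg)
  have hb : ∀ (t : ℝ) (g : ℝ → ℝ), Integrable g (gaussianReal 0 1) →
      Integrable (fun x : ℝ => (g x).toNNReal • Complex.exp (t * x * Complex.I))
        (gaussianReal 0 1) := by
    intro t g hg
    refine Integrable.mono' hg.norm ?_ (ae_of_all _ fun x => ?_)
    · exact (hg.1.aemeasurable.real_toNNReal.aestronglyMeasurable).smul (by fun_prop)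
    · rw [NNReal.smul_def, norm_smul, ← Complex.ofReal_mul, Complex.norm_exp_ofReal_mul_I,
        mul_one, Real.norm_eq_abs, Real.norm_eq_abs, abs_of_nonneg (NNReal.coe_nonneg _),
        Real.coe_toNNReal']
      exact max_le (le_abs_self _) (abs_nonneg _)
  -- Vanishing of all Fourier integrals says that the positive and negative parts of `h` are
  -- densities of finite measures with the same characteristic function.
  have hchar : (gaussianReal 0 1).withDensity (fun x => ((h x).toNNReal : ℝ≥0∞)) =
      (gaussianReal 0 1).withDensity (fun x => ((-h x).toNNReal : ℝ≥0∞)) := by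
    refine Measure.ext_of_charFun ?_
    ext t
    rw [charFun_apply_real, charFun_apply_real,
      integral_withDensity_eq_integral_smul hm.real_toNNReal,
      integral_withDensity_eq_integral_smul hm'.real_toNNReal, ← sub_eq_zero,
      ← integral_sub (hb t h hi) (hb t (fun x => -h x) hi.neg)]
    rw [← integral_cexp_mul_eq_zero hh hz t]
    congr 1
    ext x
    rw [NNReal.smul_def, NNReal.smul_def, ← sub_smul, Real.coe_toNNReal', Real.coe_toNNReal',
      max_zero_sub_max_neg_zero_eq_self, Complex.real_smul, mul_comm]
  rw [withDensity_eq_iff hm.real_toNNReal.coe_nnreal_ennreal.aemeasurable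
    hm'.real_toNNReal.coe_nnreal_ennreal.aemeasurable (hfin h hi)] at hchar
  filter_upwards [hchar] with x hx
  have hx' : (h x).toNNReal = (-h x).toNNReal := by exact_mod_cast hx
  have := max_zero_sub_max_neg_zero_eq_self (h x)
  rw [← Real.coe_toNNReal', ← Real.coe_toNNReal', hx', sub_self] at this
  exact this.symm

end GaussianPolynomials

/-! ### Hermite basis and Mehler's formula -/

section Mehler

open Polynomial
open scoped NNReal ENNReal RealInnerProductSpace

lemma inner_toLp_toLp {α : Type*} [MeasurableSpace α] {μ : Measure α} {f g : α → ℝ}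
    (hf : MemLp f 2 μ) (hg : MemLp g 2 μ) :
    ⟪hf.toLp f, hg.toLp g⟫ = ∫ a, f a * g a ∂μ := by
  rw [L2.inner_def]
  refine integral_congr_ae ?_
  filter_upwards [hf.coeFn_toLp, hg.coeFn_toLp] with a ha hb
  simp [ha, hb, mul_comm]

/-- The normalized Hermite polynomial as an element of `L²` of the standard Gaussian measure. -/
noncomputable def hermiteLp (q : ℕ) : Lp ℝ 2 (gaussianReal 0 1) :=
  (√(q ! : ℝ))⁻¹ • (memLp_eval_gaussianReal 1 (hermiteReal q)).toLp _

lemma inner_hermiteLp_toLp (q : ℕ) {f : ℝ → ℝ} (hf : MemLp f 2 (gaussianReal 0 1)) :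
    ⟪hermiteLp q, hf.toLp f⟫ = (√(q ! : ℝ))⁻¹ * hermiteCoeff f q := by
  rw [hermiteLp, real_inner_smul_left, inner_toLp_toLp, hermiteCoeff]
  simp_rw [hermiteFun_eq_eval]

lemma orthonormal_hermiteLp : Orthonormal ℝ hermiteLp := by
  rw [orthonormal_iff_ite]
  intro p q
  rw [hermiteLp, hermiteLp, real_inner_smul_left, real_inner_smul_right, inner_toLp_toLp,
    integral_hermiteReal_mul_hermiteReal]
  split_ifs with h
  · subst h
    have h0 : (0 : ℝ) < p ! := by exact_mod_cast p.factorial_pos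
    rw [← mul_assoc, ← mul_inv, Real.mul_self_sqrt h0.le, inv_mul_cancel₀ h0.ne']
  · simp

lemma orthogonal_span_hermiteLp : (Submodule.span ℝ (Set.range hermiteLp))ᗮ = ⊥ := by
  rw [Submodule.eq_bot_iff]
  intro f hf
  rw [Submodule.mem_orthogonal] at hf
  have hfm := Lp.memLp f
  have hsm : StronglyMeasurable (f : ℝ → ℝ) := Lp.stronglyMeasurable f
  have hq : ∀ q, ∫ x, (hermiteReal q).eval x * f x ∂(gaussianReal 0 1) = 0 := by
    intro q
    have h := hf (hermiteLp q) (Submodule.subset_span ⟨q, rfl⟩)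
    rw [← Lp.toLp_coeFn f hfm, inner_hermiteLp_toLp] at h
    have h0 : (√(q ! : ℝ))⁻¹ ≠ 0 := by
      have : (0 : ℝ) < q ! := by exact_mod_cast q.factorial_pos
      positivity
    have := (mul_eq_zero.mp h).resolve_left h0
    simpa [hermiteCoeff, hermiteFun_eq_eval] using this
  have h0 := ae_eq_zero_of_integral_pow_mul_eq_zero hsm.measurable hfm fun n => by
    simpa using integral_eval_mul_eq_zero hfm hq (X ^ n)
  exact (Lp.eq_zero_iff_ae_eq_zero).mpr h0

/-- The Hermite basis of `L²` of the standard Gaussian measure. -/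
noncomputable def hermiteBasis : HilbertBasis ℕ ℝ (Lp ℝ 2 (gaussianReal 0 1)) :=
  HilbertBasis.mkOfOrthogonalEqBot orthonormal_hermiteLp orthogonal_span_hermiteLp

lemma hermiteBasis_apply (q : ℕ) : hermiteBasis q = hermiteLp q := by
  rw [hermiteBasis, HilbertBasis.coe_mkOfOrthogonalEqBot]

/-- Parseval's identity for the Hermite expansion. -/
lemma hasSum_hermiteCoeff_sq {f : ℝ → ℝ} (hf : MemLp f 2 (gaussianReal 0 1)) :
    HasSum (fun q : ℕ => hermiteCoeff f q ^ 2 / (q ! : ℝ)) (∫ x, f x ^ 2 ∂(gaussianReal 0 1)) := by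
  have h := hermiteBasis.hasSum_inner_mul_inner (hf.toLp f) (hf.toLp f)
  rw [inner_toLp_toLp] at h
  convert! h using 1
  · ext q
    rw [real_inner_comm, hermiteBasis_apply, inner_hermiteLp_toLp]
    have h0 : (0 : ℝ) < q ! := by exact_mod_cast q.factorial_pos
    rw [mul_mul_mul_comm, ← mul_inv, Real.mul_self_sqrt h0.le]
    field_simp
  · simp_rw [sq]

variable {Ω : Type*} [MeasurableSpace Ω] {P : Measure Ω} {X Y : Ω → ℝ}
  {ρ : ℝ}

lemma measurePreserving_gaussianReal (hX : HasGaussianLaw X P) (hXm : Measurable X)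
    (h0 : ∫ ω, X ω ∂P = 0) (h1 : ∫ ω, X ω ^ 2 ∂P = 1) :
    MeasurePreserving X P (gaussianReal 0 1) := by
  refine ⟨hXm, ?_⟩
  rw [hX.map_eq_gaussianReal, variance_of_integral_eq_zero hXm.aemeasurable h0, h1, h0]
  simp

variable [IsProbabilityMeasure P]

/-- The mixed moments of Hermite polynomials of a bivariate Gaussian vector. -/
lemma integral_hermiteReal_mul_of_hasGaussianLaw
    (hXY : HasGaussianLaw (fun ω => (X ω, Y ω)) P) (hXm : Measurable X) (hYm : Measurable Y)
    (hX0 : ∫ ω, X ω ∂P = 0) (hY0 : ∫ ω, Y ω ∂P = 0)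
    (hX1 : ∫ ω, X ω ^ 2 ∂P = 1) (hY1 : ∫ ω, Y ω ^ 2 ∂P = 1)
    (hρ : ∫ ω, X ω * Y ω ∂P = ρ) (p q : ℕ) :
    ∫ ω, (hermiteReal p).eval (X ω) * (hermiteReal q).eval (Y ω) ∂P =
      if p = q then ρ ^ q * (q ! : ℝ) else 0 := by
  have hXmp := measurePreserving_gaussianReal hXY.fst hXm hX0 hX1
  have hYmp := measurePreserving_gaussianReal hXY.snd hYm hY0 hY1
  have hX2 := hXY.fst.memLp_two
  have hY2 := hXY.snd.memLp_two
  -- The regression residual is uncorrelated with `X`, hence independent of it by joint Gaussianity,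
  -- with variance `1 - ρ²`. Integrating it out applies the Ornstein–Uhlenbeck operator to `H_q`.
  set W : Ω → ℝ := fun ω => Y ω - ρ * X ω with hW
  have hWm : Measurable W := hYm.sub (hXm.const_mul ρ)
  have hXW : HasGaussianLaw (fun ω => (X ω, W ω)) P := by
    have := hXY.map ((ContinuousLinearMap.fst ℝ ℝ ℝ).prod
      (ContinuousLinearMap.snd ℝ ℝ ℝ - ρ • ContinuousLinearMap.fst ℝ ℝ ℝ))
    exact this
  have hW0 : ∫ ω, W ω ∂P = 0 := by
    simp only [hW]
    rw [integral_sub hXY.snd.integrable (hXY.fst.integrable.const_mul _), integral_const_mul,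
      hX0, hY0]
    simp
  have hXYi : Integrable (fun ω => X ω * Y ω) P := hX2.integrable_mul hY2
  have hW2 : ∫ ω, W ω ^ 2 ∂P = 1 - ρ ^ 2 := by
    have : ∀ ω, W ω ^ 2 = (Y ω ^ 2 - 2 * ρ * (X ω * Y ω)) + ρ ^ 2 * X ω ^ 2 := by
      intro ω; simp only [hW]; ring
    simp_rw [this]
    have hi : Integrable (fun ω => Y ω ^ 2 - 2 * ρ * (X ω * Y ω)) P :=
      hY2.integrable_sq.sub (hXYi.const_mul _)
    rw [integral_add hi (hX2.integrable_sq.const_mul _),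
      integral_sub hY2.integrable_sq (hXYi.const_mul _), integral_const_mul, integral_const_mul,
      hX1, hY1, hρ]
    ring
  have hXWc : ∫ ω, X ω * W ω ∂P = 0 := by
    have : ∀ ω, X ω * W ω = X ω * Y ω - ρ * X ω ^ 2 := by
      intro ω; simp only [hW]; ring
    simp_rw [this]
    rw [integral_sub hXYi (hX2.integrable_sq.const_mul _), integral_const_mul, hX1, hρ]
    ring
  have hv0 : 0 ≤ 1 - ρ ^ 2 := by
    rw [← hW2]; exact integral_nonneg fun _ => sq_nonneg _
  have hWlaw : P.map W = gaussianReal 0 (1 - ρ ^ 2).toNNReal := by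
    rw [hXW.snd.map_eq_gaussianReal, variance_of_integral_eq_zero hWm.aemeasurable hW0, hW2, hW0]
  have hind : IndepFun X W P := by
    refine hXW.indepFun_of_covariance_eq_zero ?_
    rw [covariance_eq_sub hX2 hXW.snd.memLp_two, hX0]
    simpa using hXWc
  have hlaw : P.map (fun ω => (X ω, W ω)) =
      (gaussianReal 0 1).prod (gaussianReal 0 (1 - ρ ^ 2).toNNReal) := by
    rw [(indepFun_iff_map_prod_eq_prod_map_map hXm.aemeasurable hWm.aemeasurable).mp hind,
      hXmp.map_eq, hWlaw]
  set F : ℝ × ℝ → ℝ := fun z => (hermiteReal p).eval z.1 * (hermiteReal q).eval (ρ * z.1 + z.2)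
    with hF
  have hFc : Continuous F := by
    refine ((hermiteReal p).continuous.comp continuous_fst).mul
      ((hermiteReal q).continuous.comp ?_)
    fun_prop
  have hFeq : ∀ ω, (hermiteReal p).eval (X ω) * (hermiteReal q).eval (Y ω) = F (X ω, W ω) := by
    intro ω; simp [hF, hW]
  have hFi : Integrable F ((gaussianReal 0 1).prod (gaussianReal 0 (1 - ρ ^ 2).toNNReal)) := by
    rw [← hlaw, integrable_map_measure hFc.aestronglyMeasurable (by fun_prop)]
    refine Integrable.congr ?_ (ae_of_all _ hFeq)
    exact ((memLp_eval_gaussianReal 1 (hermiteReal p)).comp_measurePreserving hXmp).integrable_mul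
      ((memLp_eval_gaussianReal 1 (hermiteReal q)).comp_measurePreserving hYmp)
  simp_rw [hFeq]
  rw [← integral_map (hXm.prodMk hWm).aemeasurable hFc.aestronglyMeasurable, hlaw,
    integral_prod F hFi]
  simp only [hF]
  simp_rw [integral_const_mul]
  simp_rw [integral_hermiteReal_add_gaussianReal ρ (1 - ρ ^ 2).toNNReal
    (by rw [Real.coe_toNNReal _ hv0]; ring) q]
  simp_rw [mul_left_comm _ (ρ ^ q)]
  rw [integral_const_mul, integral_hermiteReal_mul_hermiteReal]
  split_ifs <;> simp

/-- Mehler's formula: the covariance of a square integrable functional of the two coordinates of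
a standard bivariate Gaussian vector. -/
lemma hasSum_integral_mul_of_hasGaussianLaw
    (hXY : HasGaussianLaw (fun ω => (X ω, Y ω)) P) (hXm : Measurable X) (hYm : Measurable Y)
    (hX0 : ∫ ω, X ω ∂P = 0) (hY0 : ∫ ω, Y ω ∂P = 0)
    (hX1 : ∫ ω, X ω ^ 2 ∂P = 1) (hY1 : ∫ ω, Y ω ^ 2 ∂P = 1)
    (hρ : ∫ ω, X ω * Y ω ∂P = ρ) {f : ℝ → ℝ} (hf : MemLp f 2 (gaussianReal 0 1)) :
    HasSum (fun q : ℕ => ρ ^ q * (hermiteCoeff f q ^ 2 / (q ! : ℝ)))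
      (∫ ω, f (X ω) * f (Y ω) ∂P) := by
  have hXmp := measurePreserving_gaussianReal hXY.fst hXm hX0 hX1
  have hYmp := measurePreserving_gaussianReal hXY.snd hYm hY0 hY1
  -- Composition with `X` or `Y` embeds the Gaussian `L²` isometrically into `L²(P)`. These
  -- embeddings are continuous, so the Hermite expansion of `f` may be inserted in each slot of the
  -- inner product.
  set TX := Lp.compMeasurePreservingₗᵢ ℝ (E := ℝ) (p := 2) X hXmp with hTX
  set TY := Lp.compMeasurePreservingₗᵢ ℝ (E := ℝ) (p := 2) Y hYmp with hTY
  have hTXv : ∀ {g : ℝ → ℝ} (hg : MemLp g 2 (gaussianReal 0 1)),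
      TX (hg.toLp g) = (hg.comp_measurePreserving hXmp).toLp _ := fun hg => rfl
  have hTYv : ∀ {g : ℝ → ℝ} (hg : MemLp g 2 (gaussianReal 0 1)),
      TY (hg.toLp g) = (hg.comp_measurePreserving hYmp).toLp _ := fun hg => rfl
  have hee : ∀ p q, ⟪TX (hermiteLp p), TY (hermiteLp q)⟫ = if p = q then ρ ^ q else 0 := by
    intro p q
    rw [hermiteLp, hermiteLp, map_smul, map_smul, real_inner_smul_left, real_inner_smul_right,
      hTXv, hTYv, inner_toLp_toLp]
    simp only [Function.comp_apply]
    rw [integral_hermiteReal_mul_of_hasGaussianLaw hXY hXm hYm hX0 hY0 hX1 hY1 hρ]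
    split_ifs with h
    · subst h
      have h0 : (0 : ℝ) < p ! := by exact_mod_cast p.factorial_pos
      rw [← mul_assoc, ← mul_inv, Real.mul_self_sqrt h0.le, mul_comm, mul_assoc,
        mul_inv_cancel₀ h0.ne', mul_one]
    · simp
  set F := hf.toLp f with hFdef
  have hsum := hermiteBasis.hasSum_repr F
  have hcoef : ∀ q, hermiteBasis.repr F q = (√(q ! : ℝ))⁻¹ * hermiteCoeff f q := by
    intro q
    rw [HilbertBasis.repr_apply_apply, hermiteBasis_apply, hFdef, inner_hermiteLp_toLp]
  have hinner : ∀ p, ⟪TX (hermiteLp p), TY F⟫ = ρ ^ p * ((√(p ! : ℝ))⁻¹ * hermiteCoeff f p) := by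
    intro p
    have h := hsum.mapL ((innerSL ℝ (TX (hermiteLp p))).comp TY.toContinuousLinearMap)
    refine h.unique ?_
    convert! hasSum_ite_eq p (ρ ^ p * ((√(p ! : ℝ))⁻¹ * hermiteCoeff f p)) using 1
    ext q
    rw [hcoef, hermiteBasis_apply]
    simp only [ContinuousLinearMap.comp_apply, LinearIsometry.coe_toContinuousLinearMap,
      innerSL_apply_apply, map_smul, hee]
    by_cases hpq : p = q
    · subst hpq; simp; ring
    · simp [hpq, Ne.symm hpq]
  have h := hsum.mapL ((innerSL ℝ (TY F)).comp TX.toContinuousLinearMap)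
  have hval : ((innerSL ℝ (TY F)).comp TX.toContinuousLinearMap) F = ∫ ω, f (X ω) * f (Y ω) ∂P := by
    simp only [ContinuousLinearMap.comp_apply, LinearIsometry.coe_toContinuousLinearMap,
      innerSL_apply_apply]
    rw [real_inner_comm, hFdef, hTXv, hTYv, inner_toLp_toLp]
    rfl
  rw [hval] at h
  convert! h using 1
  ext q
  rw [hcoef, hermiteBasis_apply]
  simp only [ContinuousLinearMap.comp_apply, LinearIsometry.coe_toContinuousLinearMap,
    innerSL_apply_apply, map_smul]
  rw [real_inner_comm, hinner]
  have h0 : (0 : ℝ) < q ! := by exact_mod_cast q.factorial_pos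
  have hs : (√(q ! : ℝ))⁻¹ * (√(q ! : ℝ))⁻¹ = (q ! : ℝ)⁻¹ := by
    rw [← mul_inv, Real.mul_self_sqrt h0.le]
  calc ρ ^ q * (hermiteCoeff f q ^ 2 / (q ! : ℝ))
      = ρ ^ q * hermiteCoeff f q ^ 2 * (q ! : ℝ)⁻¹ := by ring
    _ = _ := by rw [← hs]; ring

/-- If the first `k` Hermite coefficients of `f` vanish, the covariance of `f(X)` and `f(Y)` is
bounded by `ρ ^ k` times the second moment of `f`. -/
lemma integral_mul_le_pow_mul_integral_sq
    (hXY : HasGaussianLaw (fun ω => (X ω, Y ω)) P) (hXm : Measurable X) (hYm : Measurable Y)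
    (hX0 : ∫ ω, X ω ∂P = 0) (hY0 : ∫ ω, Y ω ∂P = 0)
    (hX1 : ∫ ω, X ω ^ 2 ∂P = 1) (hY1 : ∫ ω, Y ω ^ 2 ∂P = 1)
    (hρ : ∫ ω, X ω * Y ω ∂P = ρ) (hρ0 : 0 ≤ ρ) (hρ1 : ρ ≤ 1)
    {f : ℝ → ℝ} (hf : MemLp f 2 (gaussianReal 0 1)) {k : ℕ}
    (hk : ∀ q < k, hermiteCoeff f q = 0) :
    ∫ ω, f (X ω) * f (Y ω) ∂P ≤ ρ ^ k * ∫ x, f x ^ 2 ∂(gaussianReal 0 1) := by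
  refine hasSum_le (fun q => ?_)
    (hasSum_integral_mul_of_hasGaussianLaw hXY hXm hYm hX0 hY0 hX1 hY1 hρ hf)
    ((hasSum_hermiteCoeff_sq hf).mul_left (ρ ^ k))
  -- Compare Mehler's series with Parseval's termwise: for `q ≥ k`, `ρ^q ≤ ρ^k` because `ρ ∈ [0,1]`.
  rcases lt_or_ge q k with hq | hq
  · simp [hk q hq]
  · exact mul_le_mul_of_nonneg_right (pow_le_pow_of_le_one hρ0 hρ1 hq) (by positivity)

end Mehler

/-! ### Second moments of integrals of random fields -/

section SecondMomentOfIntegral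

open scoped ENNReal

variable {S Ω : Type*} [MeasurableSpace Ω] {P : Measure Ω} {F : S → Ω → ℝ} {c : ℝ}

lemma integral_norm_mul_le_of_integral_sq_le (hL : ∀ s, MemLp (F s) 2 P)
    (hc : ∀ s, ∫ ω, F s ω ^ 2 ∂P ≤ c) (s t : S) : ∫ ω, ‖F s ω * F t ω‖ ∂P ≤ c := by
  calc ∫ ω, ‖F s ω * F t ω‖ ∂P ≤ ∫ ω, (F s ω ^ 2 + F t ω ^ 2) / 2 ∂P := by
        refine integral_mono ((hL s).integrable_mul (hL t)).norm
          (((hL s).integrable_sq.add (hL t).integrable_sq).div_const 2) fun ω => ?_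
        simp only [Real.norm_eq_abs, abs_mul]
        nlinarith [sq_abs (F s ω), sq_abs (F t ω), sq_nonneg (|F s ω| - |F t ω|)]
    _ ≤ c := by
        rw [integral_div, integral_add (hL s).integrable_sq (hL t).integrable_sq]
        linarith [hc s, hc t]

variable [MeasurableSpace S] {μ : Measure S} [IsFiniteMeasure μ] [IsProbabilityMeasure P]

/-- A measurable random field with bounded second moments is integrable on the product space. -/
lemma integrable_uncurry_of_integral_sq_le (hF : Measurable (Function.uncurry F))
    (hL : ∀ s, MemLp (F s) 2 P) (hc : ∀ s, ∫ ω, F s ω ^ 2 ∂P ≤ c) :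
    Integrable (Function.uncurry F) (μ.prod P) := by
  rw [integrable_prod_iff hF.aestronglyMeasurable]
  refine ⟨ae_of_all _ fun s => (hL s).integrable one_le_two, ?_⟩
  refine Integrable.mono' (integrable_const (1 + c))
    (hF.norm.stronglyMeasurable.integral_prod_right).aestronglyMeasurable
    (ae_of_all _ fun s => ?_)
  rw [Real.norm_eq_abs, abs_of_nonneg (integral_nonneg fun _ => norm_nonneg _)]
  calc ∫ ω, ‖F s ω‖ ∂P ≤ ∫ ω, (1 + F s ω ^ 2) ∂P := by
        refine integral_mono ((hL s).integrable one_le_two).norm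
          ((integrable_const _).add (hL s).integrable_sq) fun ω => ?_
        simp only [Real.norm_eq_abs]
        nlinarith [sq_abs (F s ω), sq_nonneg (|F s ω| - 1), abs_nonneg (F s ω)]
    _ ≤ 1 + c := by
        rw [integral_add (integrable_const _) (hL s).integrable_sq]
        simpa using hc s

/-- A uniform second moment bound controls all mixed moments by AM–GM, and `μ` is finite. This
justifies Fubini for the squared integral. -/
lemma integrable_mul_prod_of_integral_sq_le (hF : Measurable (Function.uncurry F))
    (hL : ∀ s, MemLp (F s) 2 P) (hc : ∀ s, ∫ ω, F s ω ^ 2 ∂P ≤ c) :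
    Integrable (fun z : (S × S) × Ω => F z.1.1 z.2 * F z.1.2 z.2) ((μ.prod μ).prod P) := by
  have hm : Measurable (fun z : (S × S) × Ω => F z.1.1 z.2 * F z.1.2 z.2) := by
    refine Measurable.mul ?_ ?_
    · exact hF.comp (f := fun z : (S × S) × Ω => (z.1.1, z.2)) (by fun_prop)
    · exact hF.comp (f := fun z : (S × S) × Ω => (z.1.2, z.2)) (by fun_prop)
  rw [integrable_prod_iff hm.aestronglyMeasurable]
  refine ⟨ae_of_all _ fun s => (hL s.1).integrable_mul (hL s.2), ?_⟩
  refine Integrable.mono' (integrable_const c)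
    (hm.norm.stronglyMeasurable.integral_prod_right').aestronglyMeasurable
    (ae_of_all _ fun s => ?_)
  rw [Real.norm_eq_abs, abs_of_nonneg (integral_nonneg fun _ => norm_nonneg _)]
  exact integral_norm_mul_le_of_integral_sq_le hL hc s.1 s.2

/-- The second moment of the integral of a random field is the integral of its covariance. -/
lemma memLp_integral_and_integral_sq_eq (hF : Measurable (Function.uncurry F))
    (hL : ∀ s, MemLp (F s) 2 P) (hc : ∀ s, ∫ ω, F s ω ^ 2 ∂P ≤ c) :
    MemLp (fun ω => ∫ s, F s ω ∂μ) 2 P ∧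
      ∫ ω, (∫ s, F s ω ∂μ) ^ 2 ∂P = ∫ z, ∫ ω, F z.1 ω * F z.2 ω ∂P ∂(μ.prod μ) := by
  have hi := integrable_mul_prod_of_integral_sq_le (μ := μ) hF hL hc
  have hsq : ∀ ω, (∫ s, F s ω ∂μ) ^ 2 = ∫ z, F z.1 ω * F z.2 ω ∂(μ.prod μ) := by
    intro ω
    rw [integral_prod_mul (fun s => F s ω) (fun s => F s ω), sq]
  have hm : StronglyMeasurable (fun ω => ∫ s, F s ω ∂μ) :=
    hF.stronglyMeasurable.integral_prod_left
  refine ⟨?_, ?_⟩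
  · rw [memLp_two_iff_integrable_sq hm.aestronglyMeasurable]
    simp_rw [hsq]
    exact hi.integral_prod_right
  · simp_rw [hsq]
    exact (integral_integral_swap (f := fun (z : S × S) (ω : Ω) => F z.1 ω * F z.2 ω) hi).symm

end SecondMomentOfIntegral

/-! ### Law and density of the distance between two random points -/

section PairDistance

open scoped ENNReal

variable {d : ℕ} {K : Set (EuclideanSpace ℝ (Fin d))}

lemma pairDistanceDensity_nonneg (K : Set (EuclideanSpace ℝ (Fin d)))
    [IsFiniteMeasure (pairDistanceLaw K)] (z : ℝ) : 0 ≤ pairDistanceDensity K z := by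
  refine Monotone.deriv_nonneg ?_
  intro a b hab
  exact measureReal_mono (Iic_subset_Iic.mpr hab)

/-- The derivative of a distribution function is almost everywhere the density of the absolutely
continuous part. An inequality suffices, as (ii) serves only to bound `I_m` from below; absolute
continuity of the law need not be proved. -/
lemma withDensity_pairDistanceDensity_le [IsProbabilityMeasure (pairDistanceLaw K)] :
    volume.withDensity (fun z => ENNReal.ofReal (pairDistanceDensity K z)) ≤ pairDistanceLaw K := by
  have hcdf : (fun r => (pairDistanceLaw K).real (Iic r)) = cdf (pairDistanceLaw K) := by
    ext r; rw [cdf_eq_real]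
  have hae : (fun z => ENNReal.ofReal (pairDistanceDensity K z)) =ᵐ[volume]
      (pairDistanceLaw K).rnDeriv volume := by
    have h := (cdf (pairDistanceLaw K)).ae_hasDerivAt
    rw [measure_cdf] at h
    filter_upwards [h, Measure.rnDeriv_lt_top (pairDistanceLaw K) volume] with z hz hlt
    rw [pairDistanceDensity, hcdf, hz.deriv, ENNReal.ofReal_toReal hlt.ne]
  rw [withDensity_congr_ae hae]
  exact Measure.withDensity_rnDeriv_le _ _

lemma setIntegral_mul_pairDistanceDensity_le [IsProbabilityMeasure (pairDistanceLaw K)]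
    {f : ℝ → ℝ} (hf : Measurable f) (hf0 : ∀ z, 0 ≤ f z) (hfi : Integrable f (pairDistanceLaw K))
    (s : Set ℝ) :
    ∫ z in s, f z * pairDistanceDensity K z ≤ ∫ z, f z ∂(pairDistanceLaw K) := by
  have hψm : Measurable (pairDistanceDensity K) := measurable_deriv _
  have hnn : ∀ z, 0 ≤ f z * pairDistanceDensity K z := fun z =>
    mul_nonneg (hf0 z) (pairDistanceDensity_nonneg K z)
  rw [integral_eq_lintegral_of_nonneg_ae (ae_of_all _ hnn)
      (hf.mul hψm).aestronglyMeasurable,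
    integral_eq_lintegral_of_nonneg_ae (ae_of_all _ hf0) hf.aestronglyMeasurable]
  refine ENNReal.toReal_mono ?_ ?_
  · exact (hfi.lintegral_lt_top).ne
  · calc ∫⁻ z in s, ENNReal.ofReal (f z * pairDistanceDensity K z)
        ≤ ∫⁻ z, ENNReal.ofReal (f z * pairDistanceDensity K z) := setLIntegral_le_lintegral _ _
      _ = ∫⁻ z, ENNReal.ofReal (f z)
            ∂(volume.withDensity fun z => ENNReal.ofReal (pairDistanceDensity K z)) := by
          rw [lintegral_withDensity_eq_lintegral_mul _ hψm.ennreal_ofReal hf.ennreal_ofReal]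
          refine lintegral_congr fun z => ?_
          rw [Pi.mul_apply, mul_comm, ENNReal.ofReal_mul (pairDistanceDensity_nonneg K z)]
      _ ≤ _ := lintegral_mono' withDensity_pairDistanceDensity_le le_rfl

end PairDistance

/-! ### Pointwise covariance estimates for the field -/

section GaussianField

variable {d : ℕ} {Ω : Type*} [MeasurableSpace Ω] {P : Measure Ω}
  {Z : EuclideanSpace ℝ (Fin d) → ℝ → Ω → ℝ} {C : ℝ → ℝ → ℝ}

namespace IsIsotropicStationaryGaussianField

lemma measurable_apply (hZ : IsIsotropicStationaryGaussianField Z C P)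
    (x : EuclideanSpace ℝ (Fin d)) (t : ℝ) : Measurable (Z x t) :=
  hZ.measurable.comp (f := fun ω : Ω => ((x, t), ω)) (by fun_prop)

lemma hasGaussianLaw_pair (hZ : IsIsotropicStationaryGaussianField Z C P)
    (x y : EuclideanSpace ℝ (Fin d)) (t s : ℝ) :
    HasGaussianLaw (fun ω => (Z x t ω, Z y s ω)) P :=
  hZ.gaussian.hasGaussianLaw_prodMk (s := (x, t)) (t := (y, s))

lemma measurePreserving (hZ : IsIsotropicStationaryGaussianField Z C P)
    (x : EuclideanSpace ℝ (Fin d)) (t : ℝ) : MeasurePreserving (Z x t) P (gaussianReal 0 1) :=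
  measurePreserving_gaussianReal (hZ.hasGaussianLaw_pair x x t t).fst (hZ.measurable_apply x t)
    (hZ.mean_zero x t) (hZ.unit_variance x t)

lemma memLp_comp (hZ : IsIsotropicStationaryGaussianField Z C P) {f : ℝ → ℝ}
    (hf : MemLp f 2 (gaussianReal 0 1)) (x : EuclideanSpace ℝ (Fin d)) (t : ℝ) :
    MemLp (fun ω => f (Z x t ω)) 2 P :=
  hf.comp_measurePreserving (hZ.measurePreserving x t)

lemma integral_comp (hZ : IsIsotropicStationaryGaussianField Z C P) {f : ℝ → ℝ}
    (hf : Measurable f) (x : EuclideanSpace ℝ (Fin d)) (t : ℝ) :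
    ∫ ω, f (Z x t ω) ∂P = ∫ ξ, f ξ ∂(gaussianReal 0 1) := by
  rw [← (hZ.measurePreserving x t).map_eq, integral_map (hZ.measurable_apply x t).aemeasurable
    hf.aestronglyMeasurable]

lemma covariance_mem_Icc (hZ : IsIsotropicStationaryGaussianField Z C P)
    (x y : EuclideanSpace ℝ (Fin d)) (t s : ℝ) : C ‖x - y‖ |t - s| ∈ Icc (0 : ℝ) 1 := by
  have h1 := hZ.covariance x y t s
  refine ⟨h1 ▸ hZ.covariance_nonneg x y t s, ?_⟩
  rw [← h1]
  have hX := (hZ.hasGaussianLaw_pair x y t s).fst.memLp_two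
  have hY := (hZ.hasGaussianLaw_pair x y t s).snd.memLp_two
  calc ∫ ω, Z x t ω * Z y s ω ∂P ≤ ∫ ω, (Z x t ω ^ 2 + Z y s ω ^ 2) / 2 ∂P := by
        refine integral_mono (hX.integrable_mul hY)
          ((hX.integrable_sq.add hY.integrable_sq).div_const 2) fun ω => ?_
        simp only
        nlinarith [sq_nonneg (Z x t ω - Z y s ω)]
    _ = 1 := by
        rw [integral_div, integral_add hX.integrable_sq hY.integrable_sq, hZ.unit_variance,
          hZ.unit_variance]
        norm_num

lemma integral_comp_mul_comp_le [IsProbabilityMeasure P]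
    (hZ : IsIsotropicStationaryGaussianField Z C P)
    {f : ℝ → ℝ} (hf : MemLp f 2 (gaussianReal 0 1)) {k : ℕ}
    (hk : ∀ q < k, hermiteCoeff f q = 0) (x y : EuclideanSpace ℝ (Fin d)) (t s : ℝ) :
    ∫ ω, f (Z x t ω) * f (Z y s ω) ∂P ≤
      C ‖x - y‖ |t - s| ^ k * ∫ ξ, f ξ ^ 2 ∂(gaussianReal 0 1) :=
  integral_mul_le_pow_mul_integral_sq (hZ.hasGaussianLaw_pair x y t s) (hZ.measurable_apply x t)
    (hZ.measurable_apply y s) (hZ.mean_zero x t) (hZ.mean_zero y s) (hZ.unit_variance x t)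
    (hZ.unit_variance y s) (hZ.covariance x y t s) (hZ.covariance_mem_Icc x y t s).1
    (hZ.covariance_mem_Icc x y t s).2 hf hk

lemma integral_hermiteFun_mul_hermiteFun [IsProbabilityMeasure P]
    (hZ : IsIsotropicStationaryGaussianField Z C P) (m : ℕ)
    (x y : EuclideanSpace ℝ (Fin d)) (t s : ℝ) :
    ∫ ω, hermiteFun m (Z x t ω) * hermiteFun m (Z y s ω) ∂P =
      C ‖x - y‖ |t - s| ^ m * (m ! : ℝ) := by
  simp_rw [hermiteFun_eq_eval]
  rw [integral_hermiteReal_mul_of_hasGaussianLaw (hZ.hasGaussianLaw_pair x y t s)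
    (hZ.measurable_apply x t) (hZ.measurable_apply y s) (hZ.mean_zero x t) (hZ.mean_zero y s)
    (hZ.unit_variance x t) (hZ.unit_variance y s) (hZ.covariance x y t s), if_pos rfl]

/-- The covariance function is measurable on the closed quadrant. -/
lemma measurable_covariance [SFinite P] (hd : 1 ≤ d)
    (hZ : IsIsotropicStationaryGaussianField Z C P) :
    Measurable (fun p : ℝ × ℝ => C |p.1| |p.2|) := by
  set e : EuclideanSpace ℝ (Fin d) := EuclideanSpace.single (⟨0, hd⟩ : Fin d) (1 : ℝ) with he
  have hC : (fun p : ℝ × ℝ => C |p.1| |p.2|) =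
      fun p => ∫ ω, Z (p.1 • e) p.2 ω * Z 0 0 ω ∂P := by
    ext p
    rw [hZ.covariance]
    simp [he, norm_smul]
  rw [hC]
  have hm : Measurable (fun z : (ℝ × ℝ) × Ω => Z (z.1.1 • e) z.1.2 z.2 * Z 0 0 z.2) := by
    refine Measurable.mul ?_ ((hZ.measurable_apply 0 0).comp measurable_snd)
    exact hZ.measurable.comp (f := fun z : (ℝ × ℝ) × Ω => ((z.1.1 • e, z.1.2), z.2)) (by fun_prop)
  exact (hm.stronglyMeasurable.integral_prod_right').measurable

/-- For `d ≥ 1` every nonnegative distance is realized along a coordinate axis. The absolute values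
keep the arguments in the quadrant where the field determines `C`; elsewhere `C` is arbitrary. -/
lemma abs_covariance_le_one (hd : 1 ≤ d) (hZ : IsIsotropicStationaryGaussianField Z C P)
    (z τ : ℝ) : C |z| |τ| ∈ Icc (0 : ℝ) 1 := by
  have h := hZ.covariance_mem_Icc (z • EuclideanSpace.single (⟨0, hd⟩ : Fin d) (1 : ℝ)) 0 τ 0
  simpa [norm_smul] using h

end IsIsotropicStationaryGaussianField

end GaussianField

/-! ### Moments of the local functionals -/

section LocalFunctional

variable {d : ℕ} {Ω : Type*} [MeasurableSpace Ω] {P : Measure Ω}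
  {Z : EuclideanSpace ℝ (Fin d) → ℝ → Ω → ℝ} {C : ℝ → ℝ → ℝ}
  {K : Set (EuclideanSpace ℝ (Fin d))} {T : ℝ} {f : ℝ → ℝ}

lemma hermiteFun_memLp (q : ℕ) : MemLp (hermiteFun q) 2 (gaussianReal 0 1) := by
  have h : hermiteFun q = fun x => (hermiteReal q).eval x := funext (hermiteFun_eq_eval q)
  rw [h]; exact memLp_eval_gaussianReal 1 _

lemma measurable_hermiteFun (q : ℕ) : Measurable (hermiteFun q) := by
  have h : hermiteFun q = fun x => (hermiteReal q).eval x := funext (hermiteFun_eq_eval q)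
  rw [h]; exact (hermiteReal q).continuous.measurable

/-- Lebesgue measure on `(0, T] × K`. -/
noncomputable def timeSpaceMeasure (K : Set (EuclideanSpace ℝ (Fin d))) (T : ℝ) :
    Measure (ℝ × EuclideanSpace ℝ (Fin d)) :=
  (volume.restrict (Ioc 0 T)).prod (volume.restrict K)

/-- `∫∫ C(‖x - y‖, |t - s|)^n` over pairs of points of `(0, T] × K`. -/
noncomputable def covariancePowerIntegral (K : Set (EuclideanSpace ℝ (Fin d))) (C : ℝ → ℝ → ℝ)
    (n : ℕ) (T : ℝ) : ℝ :=
  ∫ z, C ‖z.1.2 - z.2.2‖ |z.1.1 - z.2.1| ^ n ∂((timeSpaceMeasure K T).prod (timeSpaceMeasure K T))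

lemma isFiniteMeasure_restrict_of_isCompact (hK : IsCompact K) :
    IsFiniteMeasure (volume.restrict K) :=
  isFiniteMeasure_restrict.mpr hK.measure_lt_top.ne

lemma isFiniteMeasure_timeSpaceMeasure (hK : IsCompact K) (T : ℝ) :
    IsFiniteMeasure (timeSpaceMeasure K T) := by
  have := isFiniteMeasure_restrict_of_isCompact hK
  rw [timeSpaceMeasure]; infer_instance

lemma measurable_uncurry_field (hZ : IsIsotropicStationaryGaussianField Z C P)
    (hf : Measurable f) :
    Measurable (Function.uncurry
      (fun (p : ℝ × EuclideanSpace ℝ (Fin d)) (ω : Ω) => f (Z p.2 p.1 ω))) :=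
  hf.comp (hZ.measurable.comp
    (f := fun q : (ℝ × EuclideanSpace ℝ (Fin d)) × Ω => ((q.1.2, q.1.1), q.2)) (by fun_prop))

lemma measurable_localFunctional (hK : IsCompact K)
    (hZ : IsIsotropicStationaryGaussianField Z C P) (hf : Measurable f) (T : ℝ) :
    Measurable (localFunctional K Z f T) := by
  have := isFiniteMeasure_restrict_of_isCompact hK
  have h1 : StronglyMeasurable (fun q : ℝ × Ω => ∫ x in K, f (Z x q.1 q.2)) := by
    have h : Measurable (fun q : (ℝ × Ω) × EuclideanSpace ℝ (Fin d) => f (Z q.2 q.1.1 q.1.2)) :=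
      hf.comp (hZ.measurable.comp (f := fun q : (ℝ × Ω) × EuclideanSpace ℝ (Fin d) =>
        ((q.2, q.1.1), q.1.2)) (by fun_prop))
    exact h.stronglyMeasurable.integral_prod_right'
  have h2 : ∀ a b : ℝ, Measurable fun ω => ∫ t in Ioc a b, ∫ x in K, f (Z x t ω) := fun a b =>
    (h1.integral_prod_left' (μ := volume.restrict (Ioc a b))).measurable
  -- The interval integral is by definition this difference, so negative `T` is covered too.
  exact (h2 0 T).sub (h2 T 0)

lemma integrable_covariance_pow [SFinite P] (hd : 1 ≤ d) (hK : IsCompact K)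
    (hZ : IsIsotropicStationaryGaussianField Z C P) (n : ℕ) (T : ℝ) :
    Integrable (fun z : (ℝ × EuclideanSpace ℝ (Fin d)) × (ℝ × EuclideanSpace ℝ (Fin d)) =>
      C ‖z.1.2 - z.2.2‖ |z.1.1 - z.2.1| ^ n)
      ((timeSpaceMeasure K T).prod (timeSpaceMeasure K T)) := by
  have := isFiniteMeasure_timeSpaceMeasure hK T
  have hm : Measurable (fun z : (ℝ × EuclideanSpace ℝ (Fin d)) × (ℝ × EuclideanSpace ℝ (Fin d)) =>
      C ‖z.1.2 - z.2.2‖ |z.1.1 - z.2.1| ^ n) := by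
    have h := (hZ.measurable_covariance hd).comp
      (f := fun z : (ℝ × EuclideanSpace ℝ (Fin d)) × (ℝ × EuclideanSpace ℝ (Fin d)) =>
        (‖z.1.2 - z.2.2‖, z.1.1 - z.2.1)) (by fun_prop)
    simp only [Function.comp_def, abs_norm] at h
    exact h.pow_const n
  refine Integrable.mono' (integrable_const 1) hm.aestronglyMeasurable (ae_of_all _ fun z => ?_)
  have h := hZ.covariance_mem_Icc z.1.2 z.2.2 z.1.1 z.2.1
  rw [Real.norm_eq_abs, abs_of_nonneg (pow_nonneg h.1 n)]
  exact pow_le_one₀ h.1 h.2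

variable [IsProbabilityMeasure P]

lemma integrable_timeSpaceMeasure (hK : IsCompact K)
    (hZ : IsIsotropicStationaryGaussianField Z C P) (hf : Measurable f)
    (hf2 : MemLp f 2 (gaussianReal 0 1)) (T : ℝ) :
    Integrable (Function.uncurry
      (fun (p : ℝ × EuclideanSpace ℝ (Fin d)) (ω : Ω) => f (Z p.2 p.1 ω)))
      ((timeSpaceMeasure K T).prod P) := by
  have := isFiniteMeasure_timeSpaceMeasure hK T
  exact integrable_uncurry_of_integral_sq_le (measurable_uncurry_field hZ hf)
    (fun p => hZ.memLp_comp hf2 p.2 p.1)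
    (fun p => (hZ.integral_comp (hf.pow_const 2) p.2 p.1).le)

/-- Iterated and joint integrals agree on paths integrable over `(0, T] × K`, and almost every path
is. -/
lemma localFunctional_ae_eq (hK : IsCompact K)
    (hZ : IsIsotropicStationaryGaussianField Z C P) (hf : Measurable f)
    (hf2 : MemLp f 2 (gaussianReal 0 1)) (hT : 0 ≤ T) :
    localFunctional K Z f T =ᵐ[P] fun ω => ∫ p, f (Z p.2 p.1 ω) ∂(timeSpaceMeasure K T) := by
  have := isFiniteMeasure_timeSpaceMeasure hK T
  have := isFiniteMeasure_restrict_of_isCompact hK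
  filter_upwards [(integrable_timeSpaceMeasure hK hZ hf hf2 T).prod_left_ae] with ω hω
  rw [localFunctional, intervalIntegral.integral_of_le hT]
  exact (integral_prod (fun p : ℝ × EuclideanSpace ℝ (Fin d) => f (Z p.2 p.1 ω)) hω).symm

lemma ae_integrableOn_field (hK : IsCompact K)
    (hZ : IsIsotropicStationaryGaussianField Z C P) (hf : Measurable f)
    (hf2 : MemLp f 2 (gaussianReal 0 1)) (T : ℝ) :
    ∀ᵐ ω ∂P, IntegrableOn
      (fun p : EuclideanSpace ℝ (Fin d) × ℝ => f (Z p.1 p.2 ω)) (K ×ˢ Icc 0 T) := by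
  have := isFiniteMeasure_timeSpaceMeasure hK T
  have := isFiniteMeasure_restrict_of_isCompact hK
  filter_upwards [(integrable_timeSpaceMeasure hK hZ hf hf2 T).prod_left_ae] with ω hω
  rw [IntegrableOn, Measure.volume_eq_prod, ← Measure.prod_restrict,
    ← Measure.restrict_congr_set (Ioc_ae_eq_Icc (μ := volume) (a := (0 : ℝ)) (b := T))]
  exact hω.swap

lemma integral_localFunctional (hK : IsCompact K)
    (hZ : IsIsotropicStationaryGaussianField Z C P) (hf : Measurable f)
    (hf2 : MemLp f 2 (gaussianReal 0 1)) (hT : 0 ≤ T) :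
    ∫ ω, localFunctional K Z f T ω ∂P =
      (timeSpaceMeasure K T).real univ * ∫ ξ, f ξ ∂(gaussianReal 0 1) := by
  have := isFiniteMeasure_timeSpaceMeasure hK T
  rw [integral_congr_ae (localFunctional_ae_eq hK hZ hf hf2 hT),
    ← integral_integral_swap (integrable_timeSpaceMeasure hK hZ hf hf2 T)]
  simp_rw [hZ.integral_comp hf]
  rw [integral_const, smul_eq_mul]

lemma memLp_localFunctional_and_integral_sq (hK : IsCompact K)
    (hZ : IsIsotropicStationaryGaussianField Z C P) (hf : Measurable f)
    (hf2 : MemLp f 2 (gaussianReal 0 1)) (hT : 0 ≤ T) :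
    MemLp (localFunctional K Z f T) 2 P ∧
    ∫ ω, localFunctional K Z f T ω ^ 2 ∂P =
      ∫ z, ∫ ω, f (Z z.1.2 z.1.1 ω) * f (Z z.2.2 z.2.1 ω) ∂P
        ∂((timeSpaceMeasure K T).prod (timeSpaceMeasure K T)) := by
  have := isFiniteMeasure_timeSpaceMeasure hK T
  have hae := localFunctional_ae_eq hK hZ hf hf2 hT
  obtain ⟨h1, h2⟩ := memLp_integral_and_integral_sq_eq (μ := timeSpaceMeasure K T)
    (measurable_uncurry_field hZ hf)
    (fun p => hZ.memLp_comp hf2 p.2 p.1) (fun p => (hZ.integral_comp (hf.pow_const 2) p.2 p.1).le)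
  refine ⟨h1.ae_eq hae.symm, ?_⟩
  rw [← h2]
  refine integral_congr_ae ?_
  filter_upwards [hae] with ω hω
  rw [hω]

lemma integral_localFunctional_hermiteFun_sq (hK : IsCompact K)
    (hZ : IsIsotropicStationaryGaussianField Z C P) (m : ℕ) (hT : 0 ≤ T) :
    ∫ ω, localFunctional K Z (hermiteFun m) T ω ^ 2 ∂P =
      (m ! : ℝ) * covariancePowerIntegral K C m T := by
  rw [(memLp_localFunctional_and_integral_sq hK hZ (measurable_hermiteFun m)
    (hermiteFun_memLp m) hT).2]
  simp_rw [hZ.integral_hermiteFun_mul_hermiteFun m]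
  rw [integral_mul_const, covariancePowerIntegral, mul_comm]

/-- The consequence of Mehler's formula at a pair of points, integrated over all pairs of space-time
points. -/
lemma integral_localFunctional_sq_le (hd : 1 ≤ d) (hK : IsCompact K)
    (hZ : IsIsotropicStationaryGaussianField Z C P) (hf : Measurable f)
    (hf2 : MemLp f 2 (gaussianReal 0 1)) {k : ℕ} (hk : ∀ q < k, hermiteCoeff f q = 0)
    (hT : 0 ≤ T) :
    ∫ ω, localFunctional K Z f T ω ^ 2 ∂P ≤
      covariancePowerIntegral K C k T * ∫ ξ, f ξ ^ 2 ∂(gaussianReal 0 1) := by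
  have := isFiniteMeasure_timeSpaceMeasure hK T
  rw [(memLp_localFunctional_and_integral_sq hK hZ hf hf2 hT).2, covariancePowerIntegral,
    ← integral_mul_const]
  refine integral_mono ?_ ((integrable_covariance_pow hd hK hZ k T).mul_const _) fun z =>
    hZ.integral_comp_mul_comp_le hf2 hk _ _ _ _
  exact (integrable_mul_prod_of_integral_sq_le (measurable_uncurry_field hZ hf)
    (fun p => hZ.memLp_comp hf2 p.2 p.1)
    (fun p => (hZ.integral_comp (hf.pow_const 2) p.2 p.1).le)).integral_prod_left

end LocalFunctional

/-! ### Separating time pairs from space pairs -/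

section ProductRearrangement

variable {α β : Type*} [MeasurableSpace α] [MeasurableSpace β]

lemma measurePreserving_prodProdProdComm (μ : Measure α) (ν : Measure β) [SFinite μ] [SFinite ν] :
    MeasurePreserving (fun z : (α × β) × (α × β) => ((z.1.1, z.2.1), (z.1.2, z.2.2)))
      ((μ.prod ν).prod (μ.prod ν)) ((μ.prod μ).prod (ν.prod ν)) := by
  have h1 := measurePreserving_prodAssoc μ ν (μ.prod ν)
  have h2 : MeasurePreserving (fun z : β × (α × β) => (z.2.1, (z.1, z.2.2)))
      (ν.prod (μ.prod ν)) (μ.prod (ν.prod ν)) :=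
    (measurePreserving_prodAssoc μ ν ν).comp
      ((Measure.measurePreserving_swap.prod (MeasurePreserving.id ν)).comp
        ((measurePreserving_prodAssoc ν μ ν).symm _))
  have h3 := (measurePreserving_prodAssoc μ μ (ν.prod ν)).symm _
  exact h3.comp (((MeasurePreserving.id μ).prod h2).comp h1)

end ProductRearrangement

/-! ### From time lags to pairs of times -/

section Triangle

variable {θ : ℝ → ℝ} {B T : ℝ}

lemma integrableOn_Ioc_of_bounded (hθ : Measurable θ)
    (hθ0 : ∀ τ, 0 ≤ θ τ) (hθB : ∀ τ, θ τ ≤ B) (a b : ℝ) : IntegrableOn θ (Ioc a b) :=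
  Integrable.mono' (integrable_const B) hθ.aestronglyMeasurable
    (ae_of_all _ fun τ => by rw [Real.norm_eq_abs, abs_of_nonneg (hθ0 τ)]; exact hθB τ)

/-- The weight `T - u` is the length of the set of `s` with `s + u ≤ T`. Swapping the integrals and
substituting `u = t - s` gives the half `s < t` of the square; the other half is discarded by
nonnegativity. -/
lemma setIntegral_sub_mul_le_integral_comp_sub (hθ : Measurable θ) (hθ0 : ∀ τ, 0 ≤ θ τ)
    (hθB : ∀ τ, θ τ ≤ B) :
    ∫ u in Ioc 0 T, (T - u) * θ u ≤
      ∫ p, θ (p.1 - p.2) ∂((volume.restrict (Ioc 0 T)).prod (volume.restrict (Ioc 0 T))) := by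
  have hbd : ∀ {g : ℝ × ℝ → ℝ}, Measurable g → (∀ p, ‖g p‖ ≤ B) →
      Integrable g ((volume.restrict (Ioc 0 T)).prod (volume.restrict (Ioc 0 T))) :=
    fun hg hB => Integrable.mono' (integrable_const B) hg.aestronglyMeasurable (ae_of_all _ hB)
  have hB0 : 0 ≤ B := (hθ0 0).trans (hθB 0)
  have hi1 : Integrable (fun p : ℝ × ℝ => θ (p.1 - p.2))
      ((volume.restrict (Ioc 0 T)).prod (volume.restrict (Ioc 0 T))) :=
    hbd (hθ.comp (measurable_fst.sub measurable_snd)) fun p => by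
      rw [Real.norm_eq_abs, abs_of_nonneg (hθ0 _)]; exact hθB _
  have hset : MeasurableSet {p : ℝ × ℝ | p.1 + p.2 ≤ T} :=
    measurableSet_le (by fun_prop) (by fun_prop)
  have hi2 : Integrable (fun p : ℝ × ℝ => {p : ℝ × ℝ | p.1 + p.2 ≤ T}.indicator
      (fun p => θ p.2) p) ((volume.restrict (Ioc 0 T)).prod (volume.restrict (Ioc 0 T))) :=
    hbd ((hθ.comp measurable_snd).indicator hset) fun p => by
      refine (norm_indicator_le_norm_self _ _).trans ?_
      rw [Real.norm_eq_abs, abs_of_nonneg (hθ0 _)]; exact hθB _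
  have hinner : ∀ u ∈ Ioc 0 T, (T - u) * θ u =
      ∫ s in Ioc 0 T, {p : ℝ × ℝ | p.1 + p.2 ≤ T}.indicator (fun p => θ p.2) (s, u) := by
    intro u hu
    have h1 : ∀ s, {p : ℝ × ℝ | p.1 + p.2 ≤ T}.indicator (fun p => θ p.2) (s, u) =
        (Iic (T - u)).indicator (fun _ => θ u) s := by
      intro s
      by_cases h : s + u ≤ T
      · rw [indicator_of_mem (by exact h), indicator_of_mem (by simp only [mem_Iic]; linarith)]
      · rw [indicator_of_notMem (by exact h), indicator_of_notMem (by simp only [mem_Iic]; linarith)]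
    simp_rw [h1]
    rw [setIntegral_indicator measurableSet_Iic, setIntegral_const, smul_eq_mul,
      Ioc_inter_Iic, min_eq_right (by linarith [hu.1])]
    rw [measureReal_def, Real.volume_Ioc, sub_zero, ENNReal.toReal_ofReal (by linarith [hu.2])]
  rw [setIntegral_congr_fun measurableSet_Ioc hinner, ← integral_integral_swap hi2,
    integral_prod_symm _ hi1]
  refine setIntegral_mono_on hi2.integral_prod_left hi1.integral_prod_right measurableSet_Ioc
    fun s hs => ?_
  have h1 : ∀ u, {p : ℝ × ℝ | p.1 + p.2 ≤ T}.indicator (fun p => θ p.2) (s, u) =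
      (Iic (T - s)).indicator θ u := by
    intro u
    by_cases h : s + u ≤ T
    · rw [indicator_of_mem (by exact h), indicator_of_mem (by simp only [mem_Iic]; linarith)]
    · rw [indicator_of_notMem (by exact h), indicator_of_notMem (by simp only [mem_Iic]; linarith)]
  simp_rw [h1]
  rw [setIntegral_indicator measurableSet_Iic, Ioc_inter_Iic, min_eq_right (by linarith [hs.1]),
    ← intervalIntegral.integral_of_le (by linarith [hs.2])]
  have hshift := intervalIntegral.integral_comp_sub_right (a := s) (b := T) θ s
  rw [sub_self] at hshift
  rw [← hshift, intervalIntegral.integral_of_le hs.2]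
  have hθs : Measurable fun x => θ (x - s) := hθ.comp (measurable_id.sub_const s)
  exact setIntegral_mono_set
    (integrableOn_Ioc_of_bounded hθs (fun _ => hθ0 _) (fun _ => hθB _) 0 T)
    (ae_of_all _ fun _ => hθ0 _) (Ioc_subset_Ioc_left hs.1.le).eventuallyLE

end Triangle

/-! ### Growth of the covariance power integrals -/

section CovarianceIntegrals

variable {d : ℕ} {Ω : Type*} [MeasurableSpace Ω] {P : Measure Ω}
  {Z : EuclideanSpace ℝ (Fin d) → ℝ → Ω → ℝ} {C : ℝ → ℝ → ℝ}
  {K : Set (EuclideanSpace ℝ (Fin d))} {T : ℝ}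

lemma isProbabilityMeasure_pairDistanceLaw (hK : IsCompact K) (hK0 : volume K ≠ 0) :
    IsProbabilityMeasure (pairDistanceLaw K) := by
  have : IsProbabilityMeasure (cond volume K) :=
    cond_isProbabilityMeasure_of_finite hK0 hK.measure_lt_top.ne
  exact Measure.isProbabilityMeasure_map (by fun_prop)

lemma integral_pairDistanceLaw (hK : IsCompact K) {f : ℝ → ℝ} (hf : Measurable f) :
    ∫ z, f z ∂(pairDistanceLaw K) = (volume.real K)⁻¹ * ((volume.real K)⁻¹ *
      ∫ q, f ‖q.1 - q.2‖ ∂((volume.restrict K).prod (volume.restrict K))) := by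
  have := isFiniteMeasure_restrict_of_isCompact hK
  rw [pairDistanceLaw, integral_map (by fun_prop) hf.aestronglyMeasurable, ProbabilityTheory.cond,
    Measure.prod_smul_left, Measure.prod_smul_right, integral_smul_measure, integral_smul_measure,
    ENNReal.toReal_inv, smul_eq_mul, smul_eq_mul, measureReal_def]

lemma covariance_le_of_lt (hd : 1 ≤ d) (hK : IsCompact K)
    (hZ : IsIsotropicStationaryGaussianField Z C P) (hC : CovarianceVanishes K C)
    {ε : ℝ} (hε : 0 < ε) : ∃ τ₀ : ℝ, 0 < τ₀ ∧ ∀ x ∈ K, ∀ y ∈ K, ∀ t s : ℝ, τ₀ < |t - s| →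
      C ‖x - y‖ |t - s| ≤ ε := by
  obtain ⟨τ₀, hτ₀⟩ := (hC.eventually (ge_mem_nhds hε)).exists_forall_of_atTop
  refine ⟨max τ₀ 1, by positivity, fun x hx y hy t s hts => ?_⟩
  have h := hτ₀ |t - s| ((le_max_left _ _).trans hts.le)
  have hmem : ‖x - y‖ ∈ Icc (0 : ℝ) (Metric.diam K) :=
    ⟨norm_nonneg _, by rw [← dist_eq_norm]; exact Metric.dist_le_diam_of_mem hK.isBounded hx hy⟩
  -- An unbounded real supremum defaults to `0`, so (i) controls individual values only once
  -- boundedness is known.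
  have hbdd : BddAbove (range fun z : Icc (0 : ℝ) (Metric.diam K) => |C z (|t - s|)|) := by
    refine ⟨1, ?_⟩
    rintro _ ⟨z, rfl⟩
    have := hZ.abs_covariance_le_one hd z (t - s)
    rw [abs_of_nonneg z.2.1] at this
    simp only
    rw [abs_of_nonneg this.1]; exact this.2
  exact (le_abs_self _).trans ((le_ciSup hbdd ⟨‖x - y‖, hmem⟩).trans h)

variable [IsProbabilityMeasure P]

/-- The covariance power integral in terms of the law of the distance of two random points. -/
lemma covariancePowerIntegral_eq (hd : 1 ≤ d) (hK : IsCompact K) (hK0 : volume K ≠ 0)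
    (hZ : IsIsotropicStationaryGaussianField Z C P) (n : ℕ) (T : ℝ) :
    covariancePowerIntegral K C n T =
      ∫ p, volume.real K ^ 2 * ∫ z, C |z| |p.1 - p.2| ^ n ∂(pairDistanceLaw K)
        ∂((volume.restrict (Ioc 0 T)).prod (volume.restrict (Ioc 0 T))) := by
  have := isFiniteMeasure_restrict_of_isCompact hK
  have hV : volume.real K ≠ 0 := by
    rw [measureReal_def]
    exact (ENNReal.toReal_pos hK0 hK.measure_lt_top.ne).ne'
  have hmp := measurePreserving_prodProdProdComm
    (volume.restrict (Ioc 0 T)) (volume.restrict K)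
  have hCm := hZ.measurable_covariance hd
  set F : (ℝ × ℝ) × (EuclideanSpace ℝ (Fin d) × EuclideanSpace ℝ (Fin d)) → ℝ :=
    fun w => C ‖w.2.1 - w.2.2‖ |w.1.1 - w.1.2| ^ n with hF
  have hFm : Measurable F := by
    have h := hCm.comp
      (f := fun w : (ℝ × ℝ) × (EuclideanSpace ℝ (Fin d) × EuclideanSpace ℝ (Fin d)) =>
        (‖w.2.1 - w.2.2‖, w.1.1 - w.1.2)) (by fun_prop)
    simp only [Function.comp_def, abs_norm] at h
    exact h.pow_const n
  have hFi : Integrable F (((volume.restrict (Ioc 0 T)).prod (volume.restrict (Ioc 0 T))).prod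
      ((volume.restrict K).prod (volume.restrict K))) := by
    refine Integrable.mono' (integrable_const 1) hFm.aestronglyMeasurable (ae_of_all _ fun z => ?_)
    have h := hZ.covariance_mem_Icc z.2.1 z.2.2 z.1.1 z.1.2
    rw [Real.norm_eq_abs, abs_of_nonneg (pow_nonneg h.1 n)]
    exact pow_le_one₀ h.1 h.2
  have h1 : covariancePowerIntegral K C n T =
      ∫ w, F w ∂(((volume.restrict (Ioc 0 T)).prod (volume.restrict (Ioc 0 T))).prod
        ((volume.restrict K).prod (volume.restrict K))) := by
    rw [← hmp.map_eq, integral_map hmp.measurable.aemeasurable hFm.aestronglyMeasurable]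
    rfl
  rw [h1, integral_prod _ hFi]
  refine integral_congr_ae (ae_of_all _ fun p => ?_)
  have hm : Measurable fun z => C |z| |p.1 - p.2| ^ n :=
    (hCm.comp (f := fun z => (z, p.1 - p.2)) (by fun_prop)).pow_const n
  simp only [hF]
  rw [integral_pairDistanceLaw hK hm]
  simp only [abs_norm]
  field_simp

/-- Two losses are accepted: the density is dominated by the law of the distance, and the lag
integral covers only half of the time square. What remains is a lower bound for `I_m` by the
integral in (ii). -/
lemma mul_integral_density_le_covariancePowerIntegral (hd : 1 ≤ d) (hK : IsCompact K)
    (hK0 : volume K ≠ 0) (hZ : IsIsotropicStationaryGaussianField Z C P) (m : ℕ) (hT : 0 < T) :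
    volume.real K ^ 2 * T * ∫ τ in (0 : ℝ)..T, (1 - τ / T) *
      ∫ z in (0 : ℝ)..(Metric.diam K), C z τ ^ m * pairDistanceDensity K z ≤
    covariancePowerIntegral K C m T := by
  have := isProbabilityMeasure_pairDistanceLaw hK hK0
  have hCm := hZ.measurable_covariance hd
  set θ : ℝ → ℝ := fun τ => volume.real K ^ 2 * ∫ z, C |z| |τ| ^ m ∂(pairDistanceLaw K) with hθ
  have hpow : ∀ z τ, C |z| |τ| ^ m ∈ Icc (0 : ℝ) 1 := fun z τ =>
    ⟨pow_nonneg (hZ.abs_covariance_le_one hd z τ).1 m,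
      pow_le_one₀ (hZ.abs_covariance_le_one hd z τ).1 (hZ.abs_covariance_le_one hd z τ).2⟩
  have hmz : ∀ τ, Measurable fun z => C |z| |τ| ^ m := fun τ =>
    (hCm.comp (f := fun z => (z, τ)) (by fun_prop)).pow_const m
  have hiz : ∀ τ, Integrable (fun z => C |z| |τ| ^ m) (pairDistanceLaw K) := fun τ =>
    Integrable.mono' (integrable_const 1) (hmz τ).aestronglyMeasurable (ae_of_all _ fun z => by
      rw [Real.norm_eq_abs, abs_of_nonneg (hpow z τ).1]; exact (hpow z τ).2)
  have hθ0 : ∀ τ, 0 ≤ θ τ := fun τ =>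
    mul_nonneg (sq_nonneg _) (integral_nonneg fun z => (hpow z τ).1)
  have hθB : ∀ τ, θ τ ≤ volume.real K ^ 2 := fun τ => by
    refine mul_le_of_le_one_right (sq_nonneg _) ?_
    calc ∫ z, C |z| |τ| ^ m ∂(pairDistanceLaw K) ≤ ∫ _, (1 : ℝ) ∂(pairDistanceLaw K) :=
          integral_mono (hiz τ) (integrable_const _) fun z => (hpow z τ).2
      _ = 1 := by simp
  have hθm : Measurable θ := by
    refine Measurable.const_mul ?_ _
    have h : Measurable fun q : ℝ × ℝ => C |q.2| |q.1| ^ m :=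
      (hCm.comp (f := fun q : ℝ × ℝ => (q.2, q.1)) (by fun_prop)).pow_const m
    exact (h.stronglyMeasurable.integral_prod_right').measurable
  rw [covariancePowerIntegral_eq hd hK hK0 hZ m T]
  refine le_trans ?_ (setIntegral_sub_mul_le_integral_comp_sub hθm hθ0 hθB)
  rw [intervalIntegral.integral_of_le hT.le, ← integral_const_mul]
  have hdens : ∀ τ ∈ Ioc 0 T, 0 ≤ ∫ z in (0 : ℝ)..(Metric.diam K),
      C z τ ^ m * pairDistanceDensity K z ∧ ∫ z in (0 : ℝ)..(Metric.diam K),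
      C z τ ^ m * pairDistanceDensity K z ≤ ∫ z, C |z| |τ| ^ m ∂(pairDistanceLaw K) := by
    intro τ hτ
    rw [intervalIntegral.integral_of_le Metric.diam_nonneg]
    have hcongr : ∫ z in Ioc 0 (Metric.diam K), C z τ ^ m * pairDistanceDensity K z =
        ∫ z in Ioc 0 (Metric.diam K), C |z| |τ| ^ m * pairDistanceDensity K z := by
      refine setIntegral_congr_fun measurableSet_Ioc fun z hz => ?_
      simp only [abs_of_pos hz.1, abs_of_pos hτ.1]
    rw [hcongr]
    exact ⟨integral_nonneg fun z => mul_nonneg (hpow z τ).1 (pairDistanceDensity_nonneg K z),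
      setIntegral_mul_pairDistanceDensity_le (hmz τ) (fun z => (hpow z τ).1) (hiz τ) _⟩
  -- Only the larger side has to be integrable, so measurability in `τ` of the density integral is
  -- not needed.
  refine integral_mono_of_nonneg ?_ ?_ ?_
  · filter_upwards [ae_restrict_mem measurableSet_Ioc] with τ hτ
    have h1 : 0 ≤ 1 - τ / T := by
      rw [sub_nonneg, div_le_one hT]; exact hτ.2
    have := (hdens τ hτ).1
    simp only [Pi.zero_apply]
    positivity
  · refine Integrable.mono' (integrable_const (T * volume.real K ^ 2))
      (by fun_prop) ?_
    filter_upwards [ae_restrict_mem measurableSet_Ioc] with τ hτ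
    rw [norm_mul, Real.norm_eq_abs, Real.norm_eq_abs, abs_of_nonneg (hθ0 τ),
      abs_of_nonneg (by linarith [hτ.2])]
    exact mul_le_mul (by linarith [hτ.1]) (hθB τ) (hθ0 τ) hT.le
  · filter_upwards [ae_restrict_mem measurableSet_Ioc] with τ hτ
    have h1 : 0 ≤ T - τ := by linarith [hτ.2]
    have h2 : volume.real K ^ 2 * T * ((1 - τ / T) *
        ∫ z in (0 : ℝ)..(Metric.diam K), C z τ ^ m * pairDistanceDensity K z) =
        (T - τ) * (volume.real K ^ 2 * ∫ z in (0 : ℝ)..(Metric.diam K),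
          C z τ ^ m * pairDistanceDensity K z) := by
      field_simp
    simp only [h2, hθ]
    exact mul_le_mul_of_nonneg_left
      (mul_le_mul_of_nonneg_left (hdens τ hτ).2 (sq_nonneg _)) h1

/-- Split by time lag: beyond `τ₀` one factor `C` is at most `ε`, and within the strip of lags up to
`τ₀` the integrand is at most `1`. -/
lemma covariancePowerIntegral_succ_le (hd : 1 ≤ d) (hK : IsCompact K)
    (hZ : IsIsotropicStationaryGaussianField Z C P) (hC : CovarianceVanishes K C) (m : ℕ)
    {ε : ℝ} (hε : 0 < ε) : ∃ B : ℝ, ∀ T : ℝ, 0 < T →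
      covariancePowerIntegral K C (m + 1) T ≤ ε * covariancePowerIntegral K C m T + B * T := by
  obtain ⟨τ₀, hτ₀, hle⟩ := covariance_le_of_lt hd hK hZ hC hε
  -- For each first time the admissible second times lie in an interval of length `2 τ₀`; the two
  -- space variables contribute `|K|²`.
  refine ⟨volume.real K ^ 2 * (2 * τ₀), fun T hT => ?_⟩
  have := isFiniteMeasure_restrict_of_isCompact hK
  have := isFiniteMeasure_timeSpaceMeasure hK T
  set near : Set ((ℝ × EuclideanSpace ℝ (Fin d)) × (ℝ × EuclideanSpace ℝ (Fin d))) :=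
    {z | |z.1.1 - z.2.1| ≤ τ₀} with hnear
  have hnm : MeasurableSet near := measurableSet_le (by fun_prop) (by fun_prop)
  have hmemK : ∀ᵐ z ∂((timeSpaceMeasure K T).prod (timeSpaceMeasure K T)), z.1.2 ∈ K ∧ z.2.2 ∈ K := by
    have h : timeSpaceMeasure K T = volume.restrict (Ioc 0 T ×ˢ K) := by
      rw [timeSpaceMeasure, Measure.prod_restrict, ← Measure.volume_eq_prod]
    rw [h, Measure.prod_restrict]
    filter_upwards [ae_restrict_mem ((measurableSet_Ioc.prod hK.measurableSet).prod
      (measurableSet_Ioc.prod hK.measurableSet))] with z hz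
    exact ⟨hz.1.2, hz.2.2⟩
  have hnearint : ((timeSpaceMeasure K T).prod (timeSpaceMeasure K T)).real near ≤
      volume.real K ^ 2 * (2 * τ₀) * T := by
    have hsec : ∀ p : ℝ × EuclideanSpace ℝ (Fin d), (timeSpaceMeasure K T) (Prod.mk p ⁻¹' near) ≤
        ENNReal.ofReal (2 * τ₀) * volume K := by
      intro p
      have : Prod.mk p ⁻¹' near = Icc (p.1 - τ₀) (p.1 + τ₀) ×ˢ univ := by
        ext q
        simp only [hnear, mem_preimage, mem_ofPred_eq, abs_le, mem_prod, mem_Icc, mem_univ, and_true]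
        constructor <;> rintro ⟨h1, h2⟩ <;> constructor <;> linarith
      rw [this, timeSpaceMeasure, Measure.prod_prod, Measure.restrict_apply_univ]
      refine mul_le_mul_left ((Measure.restrict_apply_le _ _).trans ?_) _
      rw [Real.volume_Icc]
      exact ENNReal.ofReal_le_ofReal (by linarith)
    have hle : ((timeSpaceMeasure K T).prod (timeSpaceMeasure K T)) near ≤
        ENNReal.ofReal (2 * τ₀) * volume K * (ENNReal.ofReal T * volume K) := by
      rw [Measure.prod_apply hnm]
      refine (lintegral_mono hsec).trans ?_
      rw [lintegral_const, timeSpaceMeasure, ← univ_prod_univ, Measure.prod_prod,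
        Measure.restrict_apply_univ, Measure.restrict_apply_univ, Real.volume_Ioc, sub_zero]
    have hfin : ENNReal.ofReal (2 * τ₀) * volume K * (ENNReal.ofReal T * volume K) ≠ ⊤ := by
      have : volume K ≠ ⊤ := hK.measure_lt_top.ne
      finiteness
    refine (ENNReal.toReal_mono hfin hle).trans (le_of_eq ?_)
    rw [ENNReal.toReal_mul, ENNReal.toReal_mul, ENNReal.toReal_mul,
      ENNReal.toReal_ofReal (by positivity), ENNReal.toReal_ofReal hT.le, measureReal_def]
    ring
  calc covariancePowerIntegral K C (m + 1) T
      ≤ ∫ z, (ε * C ‖z.1.2 - z.2.2‖ |z.1.1 - z.2.1| ^ m + near.indicator (fun _ => (1 : ℝ)) z)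
          ∂((timeSpaceMeasure K T).prod (timeSpaceMeasure K T)) := by
        refine integral_mono_ae (integrable_covariance_pow hd hK hZ _ T)
          (((integrable_covariance_pow hd hK hZ m T).const_mul ε).add
            ((integrable_const 1).indicator hnm)) ?_
        filter_upwards [hmemK] with z hz
        have h := hZ.covariance_mem_Icc z.1.2 z.2.2 z.1.1 z.2.1
        have hp := pow_nonneg h.1 m
        by_cases hzn : z ∈ near
        · rw [indicator_of_mem hzn]
          have := pow_le_one₀ (n := m + 1) h.1 h.2
          nlinarith
        · rw [indicator_of_notMem hzn, add_zero, pow_succ, mul_comm]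
          exact mul_le_mul_of_nonneg_right
            (hle _ hz.1 _ hz.2 _ _ (by simpa [hnear] using hzn)) hp
    _ = ε * covariancePowerIntegral K C m T +
          ((timeSpaceMeasure K T).prod (timeSpaceMeasure K T)).real near := by
        rw [integral_add ((integrable_covariance_pow hd hK hZ m T).const_mul ε)
          ((integrable_const 1).indicator hnm), integral_const_mul, covariancePowerIntegral,
          integral_indicator_const _ hnm]
        simp
    _ ≤ _ := by gcongr

/-- `I_m / T` dominates `|K|²` times the integral in (ii), which diverges even after division by
`T^δ` with `δ > 0`. -/
lemma tendsto_covariancePowerIntegral_div (hd : 1 ≤ d) (hK : IsCompact K)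
    (hK0 : volume K ≠ 0) (hZ : IsIsotropicStationaryGaussianField Z C P) {m : ℕ}
    (hC : PowerIntegralDiverges K C m) :
    Tendsto (fun T => covariancePowerIntegral K C m T / T) atTop atTop := by
  obtain ⟨δ, hδ, -, hlim⟩ := hC
  have hV : 0 < volume.real K := by
    rw [measureReal_def]
    exact ENNReal.toReal_pos hK0 hK.measure_lt_top.ne
  have h := (hlim.atTop_mul_atTop₀ (tendsto_rpow_atTop hδ)).const_mul_atTop (pow_pos hV 2)
  refine tendsto_atTop_mono' _ ?_ h
  filter_upwards [eventually_gt_atTop 0] with T hT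
  rw [le_div_iff₀ hT]
  refine le_trans (le_of_eq ?_)
    (mul_integral_density_le_covariancePowerIntegral hd hK hK0 hZ m hT)
  have : T ^ δ ≠ 0 := (Real.rpow_pos_of_pos hT δ).ne'
  field_simp

lemma tendsto_covariancePowerIntegral_succ_div (hd : 1 ≤ d) (hK : IsCompact K)
    (hK0 : volume K ≠ 0) (hZ : IsIsotropicStationaryGaussianField Z C P) {m : ℕ}
    (hC : CovarianceVanishes K C) (hCm : PowerIntegralDiverges K C m) :
    Tendsto (fun T => covariancePowerIntegral K C (m + 1) T / covariancePowerIntegral K C m T)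
      atTop (𝓝 0) := by
  have hdiv := tendsto_covariancePowerIntegral_div hd hK hK0 hZ hCm
  have hnn : ∀ n T, 0 ≤ covariancePowerIntegral K C n T := fun n T =>
    integral_nonneg fun z => pow_nonneg (hZ.covariance_mem_Icc _ _ _ _).1 n
  rw [Metric.tendsto_atTop']
  intro ε hε
  obtain ⟨B, hB⟩ := covariancePowerIntegral_succ_le hd hK hZ hC m (half_pos hε)
  have hev : ∀ᶠ T in atTop, dist (covariancePowerIntegral K C (m + 1) T /
      covariancePowerIntegral K C m T) 0 < ε := by
    -- The level `0` makes `I_m` positive; the level `B / (ε / 2)` makes `B T` smaller than `(ε / 2)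
    -- I_m`, the other half of `ε`.
    filter_upwards [hdiv.eventually_gt_atTop (max 0 (B / (ε / 2))), eventually_gt_atTop 0]
      with T h1 hT
    have hpos : 0 < covariancePowerIntegral K C m T := by
      have := (le_max_left _ _).trans_lt h1
      exact (div_pos_iff_of_pos_right hT).mp this
    have h2 := (le_max_right _ _).trans_lt h1
    rw [div_lt_div_iff₀ (half_pos hε) hT] at h2
    rw [Real.dist_eq, sub_zero, abs_of_nonneg (div_nonneg (hnn _ _) hpos.le), div_lt_iff₀ hpos]
    have := hB T hT
    linarith
  obtain ⟨N, hN⟩ := hev.exists_forall_of_atTop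
  exact ⟨N, fun T hT => hN T hT.le⟩

end CovarianceIntegrals

/-! ### The Hermite remainder of `G` -/

section HermiteRemainder

variable {G : ℝ → ℝ} {m : ℕ}

/-- The part of `G` of Hermite order greater than `m`, when `m` is the Hermite rank. -/
noncomputable def hermiteRemainder (G : ℝ → ℝ) (m : ℕ) (x : ℝ) : ℝ :=
  G x - hermiteCoeff G 0 * hermiteFun 0 x - hermiteCoeff G m / (m ! : ℝ) * hermiteFun m x

lemma hermiteFun_zero (x : ℝ) : hermiteFun 0 x = 1 := by simp [hermiteFun]

lemma measurable_hermiteRemainder (hG : Measurable G) : Measurable (hermiteRemainder G m) :=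
  (hG.sub ((measurable_hermiteFun 0).const_mul _)).sub ((measurable_hermiteFun m).const_mul _)

lemma memLp_hermiteRemainder (hG : MemLp G 2 (gaussianReal 0 1)) :
    MemLp (hermiteRemainder G m) 2 (gaussianReal 0 1) :=
  (hG.sub ((hermiteFun_memLp 0).const_mul _)).sub ((hermiteFun_memLp m).const_mul _)

lemma hermiteCoeff_hermiteFun (p q : ℕ) :
    hermiteCoeff (hermiteFun p) q = if p = q then (q ! : ℝ) else 0 := by
  rw [hermiteCoeff]
  simp_rw [hermiteFun_eq_eval]
  rw [integral_hermiteReal_mul_hermiteReal]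
  by_cases h : p = q
  · simp [h]
  · simp [h, Ne.symm h]

/-- Orders `0` and `m` are subtracted exactly, the latter with factor `1/m!` because `‖H_m‖² = m!`;
the orders between vanish by the rank condition, and `m ≥ 1` keeps the two subtractions apart. -/
lemma hermiteCoeff_hermiteRemainder (hG : MemLp G 2 (gaussianReal 0 1)) (hm : HasHermiteRank G m)
    (q : ℕ) (hq : q < m + 1) : hermiteCoeff (hermiteRemainder G m) q = 0 := by
  have h1 : Integrable (fun x => hermiteFun q x * G x) (gaussianReal 0 1) :=
    (hermiteFun_memLp q).integrable_mul hG
  have h2 (p : ℕ) : Integrable (fun x => hermiteFun q x * hermiteFun p x) (gaussianReal 0 1) :=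
    (hermiteFun_memLp q).integrable_mul (hermiteFun_memLp p)
  have hexp : hermiteCoeff (hermiteRemainder G m) q = hermiteCoeff G q -
      hermiteCoeff G 0 * hermiteCoeff (hermiteFun 0) q -
      hermiteCoeff G m / (m ! : ℝ) * hermiteCoeff (hermiteFun m) q := by
    have : ∀ x, hermiteFun q x * hermiteRemainder G m x =
        hermiteFun q x * G x - hermiteCoeff G 0 * (hermiteFun q x * hermiteFun 0 x) -
        hermiteCoeff G m / (m ! : ℝ) * (hermiteFun q x * hermiteFun m x) := by
      intro x; rw [hermiteRemainder]; ring
    rw [hermiteCoeff]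
    simp_rw [this]
    have h3 : Integrable (fun x => hermiteFun q x * G x -
        hermiteCoeff G 0 * (hermiteFun q x * hermiteFun 0 x)) (gaussianReal 0 1) :=
      h1.sub ((h2 0).const_mul _)
    rw [integral_sub h3 ((h2 m).const_mul _),
      integral_sub h1 ((h2 0).const_mul _), integral_const_mul, integral_const_mul]
    rfl
  rw [hexp, hermiteCoeff_hermiteFun, hermiteCoeff_hermiteFun]
  have hm1 := hm.one_le
  rcases Nat.eq_zero_or_pos q with rfl | hq0
  · simp [show m ≠ 0 by lia]
  · rw [if_neg hq0.ne]
    rcases (Nat.lt_succ_iff.mp hq).eq_or_lt with rfl | hlt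
    · have : (q ! : ℝ) ≠ 0 := by exact_mod_cast q.factorial_ne_zero
      rw [if_pos rfl]
      field_simp
      ring
    · rw [if_neg hlt.ne', hm.coeff_eq_zero q hq0 hlt]
      ring

lemma hermiteCoeff_zero (G : ℝ → ℝ) : hermiteCoeff G 0 = ∫ ξ, G ξ ∂(gaussianReal 0 1) := by
  simp [hermiteCoeff, hermiteFun_zero]

end HermiteRemainder

/-! ### Comparison of the normalized functionals -/

section NormalizedFunctional

variable {d : ℕ} {Ω : Type*} [MeasurableSpace Ω] {P : Measure Ω}
  {K : Set (EuclideanSpace ℝ (Fin d))} {Z : EuclideanSpace ℝ (Fin d) → ℝ → Ω → ℝ}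
  {C : ℝ → ℝ → ℝ} {G : ℝ → ℝ} {m : ℕ} {T : ℝ}

lemma eLpNorm_two_eq_ofReal_sqrt {f : Ω → ℝ} (hf : MemLp f 2 P) :
    eLpNorm f 2 P = ENNReal.ofReal √(∫ ω, f ω ^ 2 ∂P) := by
  rw [hf.eLpNorm_eq_integral_rpow_norm (by simp) (by simp), Real.sqrt_eq_rpow]
  simp

lemma measurable_normalizedFunctional (hK : IsCompact K)
    (hZ : IsIsotropicStationaryGaussianField Z C P) (hG : Measurable G) (m : ℕ) (T : ℝ) :
    Measurable (normalizedFunctional K Z P G m T) :=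
  ((measurable_localFunctional hK hZ hG T).sub_const _).div_const _

lemma measurable_normalizedHermiteFunctional (hK : IsCompact K)
    (hZ : IsIsotropicStationaryGaussianField Z C P) (G : ℝ → ℝ) (m : ℕ) (T : ℝ) :
    Measurable (normalizedHermiteFunctional K Z P G m T) :=
  ((measurable_localFunctional hK hZ (measurable_hermiteFun m) T).const_mul _).div_const _

variable [IsProbabilityMeasure P]

/-- Linearity on integrable paths: the constant component `G_0` integrates to exactly `E[A_T]`. -/
lemma localFunctional_hermiteRemainder_ae_eq (hK : IsCompact K)
    (hZ : IsIsotropicStationaryGaussianField Z C P) (hG : Measurable G)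
    (hG2 : MemLp G 2 (gaussianReal 0 1)) (m : ℕ) (hT : 0 ≤ T) :
    localFunctional K Z (hermiteRemainder G m) T =ᵐ[P] fun ω =>
      localFunctional K Z G T ω - ∫ ω', localFunctional K Z G T ω' ∂P -
        hermiteCoeff G m / (m ! : ℝ) * localFunctional K Z (hermiteFun m) T ω := by
  have := isFiniteMeasure_timeSpaceMeasure hK T
  rw [integral_localFunctional hK hZ hG hG2 hT, ← hermiteCoeff_zero]
  filter_upwards [localFunctional_ae_eq hK hZ (measurable_hermiteRemainder hG)
      (memLp_hermiteRemainder (m := m) hG2) hT, localFunctional_ae_eq hK hZ hG hG2 hT,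
    localFunctional_ae_eq hK hZ (measurable_hermiteFun m) (hermiteFun_memLp m) hT,
    (integrable_timeSpaceMeasure hK hZ hG hG2 T).prod_left_ae,
    (integrable_timeSpaceMeasure hK hZ (measurable_hermiteFun m)
      (hermiteFun_memLp m) T).prod_left_ae] with ω h1 h2 h3 h4 h5
  have h4' : Integrable (fun p : ℝ × EuclideanSpace ℝ (Fin d) => G (Z p.2 p.1 ω))
    (timeSpaceMeasure K T) := h4
  have h5' : Integrable (fun p : ℝ × EuclideanSpace ℝ (Fin d) => hermiteFun m (Z p.2 p.1 ω))
    (timeSpaceMeasure K T) := h5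
  rw [h1, h2, h3]
  simp only [hermiteRemainder, hermiteFun_zero, mul_one]
  have h6 : Integrable (fun p : ℝ × EuclideanSpace ℝ (Fin d) => G (Z p.2 p.1 ω) - hermiteCoeff G 0)
    (timeSpaceMeasure K T) := h4'.sub (integrable_const _)
  rw [integral_sub h6 (h5'.const_mul _),
    integral_sub h4' (integrable_const _), integral_const, integral_const_mul, smul_eq_mul]

lemma hermiteSigma_eq (hK : IsCompact K) (hZ : IsIsotropicStationaryGaussianField Z C P) (m : ℕ)
    (hT : 0 ≤ T) :
    hermiteSigma K Z P m T = √((m ! : ℝ) * covariancePowerIntegral K C m T) := by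
  rw [hermiteSigma, integral_localFunctional_hermiteFun_sq hK hZ m hT]

lemma normalizedFunctional_sub_ae_eq (hK : IsCompact K)
    (hZ : IsIsotropicStationaryGaussianField Z C P) (hG : Measurable G)
    (hG2 : MemLp G 2 (gaussianReal 0 1)) (hm : hermiteCoeff G m ≠ 0) (hT : 0 ≤ T)
    (hσ : 0 < hermiteSigma K Z P m T) :
    (fun ω => normalizedFunctional K Z P G m T ω - normalizedHermiteFunctional K Z P G m T ω)
      =ᵐ[P] fun ω => (|hermiteCoeff G m| * hermiteSigma K Z P m T * (1 / (m ! : ℝ)))⁻¹ *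
        localFunctional K Z (hermiteRemainder G m) T ω := by
  filter_upwards [localFunctional_hermiteRemainder_ae_eq hK hZ hG hG2 m hT] with ω hω
  rw [hω, normalizedFunctional, normalizedHermiteFunctional]
  have hmf : (m ! : ℝ) ≠ 0 := by exact_mod_cast m.factorial_ne_zero
  have hσ' := hσ.ne'
  rcases lt_or_gt_of_ne hm with h | h
  · rw [Real.sign_of_neg h, abs_of_neg h]
    field_simp
    ring
  · rw [Real.sign_of_pos h, abs_of_pos h]
    field_simp

/-- The squared normalization is `G_m² I_m / m!`, and the second moment of the remainder functional
is at most `‖R‖² I_{m+1}`. -/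
lemma eLpNorm_normalizedFunctional_sub_le (hd : 1 ≤ d) (hK : IsCompact K)
    (hZ : IsIsotropicStationaryGaussianField Z C P) (hG : Measurable G)
    (hG2 : MemLp G 2 (gaussianReal 0 1)) (hm : HasHermiteRank G m) (hT : 0 ≤ T)
    (hpos : 0 < covariancePowerIntegral K C m T) :
    eLpNorm (fun ω => normalizedFunctional K Z P G m T ω -
      normalizedHermiteFunctional K Z P G m T ω) 2 P ≤
    ENNReal.ofReal √((m ! : ℝ) * (∫ ξ, hermiteRemainder G m ξ ^ 2 ∂(gaussianReal 0 1)) /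
      hermiteCoeff G m ^ 2 *
      (covariancePowerIntegral K C (m + 1) T / covariancePowerIntegral K C m T)) := by
  have hmf : (0 : ℝ) < m ! := by exact_mod_cast m.factorial_pos
  have hσ : 0 < hermiteSigma K Z P m T := by
    rw [hermiteSigma_eq hK hZ m hT]; positivity
  have hσ2 : hermiteSigma K Z P m T ^ 2 = (m ! : ℝ) * covariancePowerIntegral K C m T := by
    rw [hermiteSigma_eq hK hZ m hT, Real.sq_sqrt (by positivity)]
  have hL := (memLp_localFunctional_and_integral_sq hK hZ (measurable_hermiteRemainder hG)
    (memLp_hermiteRemainder (m := m) hG2) hT).1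
  rw [eLpNorm_congr_ae (normalizedFunctional_sub_ae_eq hK hZ hG hG2 hm.coeff_ne_zero hT hσ),
    eLpNorm_two_eq_ofReal_sqrt (hL.const_mul _)]
  refine ENNReal.ofReal_le_ofReal (Real.sqrt_le_sqrt ?_)
  simp_rw [mul_pow]
  rw [integral_const_mul, inv_pow, mul_pow, mul_pow, sq_abs, hσ2]
  have hle := integral_localFunctional_sq_le hd hK hZ (measurable_hermiteRemainder hG)
    (memLp_hermiteRemainder (m := m) hG2) (hermiteCoeff_hermiteRemainder hG2 hm) hT
  refine (mul_le_mul_of_nonneg_left hle (by positivity)).trans (le_of_eq ?_)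
  have := hm.coeff_ne_zero
  field_simp

end NormalizedFunctional

/-! ### Reduction to the first Hermite component -/

theorem theorem1 {d : ℕ} (hd : 1 ≤ d) {Ω : Type*} [MeasurableSpace Ω]
    (P : Measure Ω) [IsProbabilityMeasure P]
    (K : Set (EuclideanSpace ℝ (Fin d)))
    (hK_convex : Convex ℝ K) (hK_compact : IsCompact K) (hK_interior : (interior K).Nonempty)
    (Z : EuclideanSpace ℝ (Fin d) → ℝ → Ω → ℝ) (C : ℝ → ℝ → ℝ)
    (hZ : IsIsotropicStationaryGaussianField Z C P)
    (G : ℝ → ℝ) (hG_measurable : Measurable G) (hG_memLp : MemLp G 2 (gaussianReal 0 1))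
    (m : ℕ) (hG_rank : HasHermiteRank G m)
    (hC_sup : CovarianceVanishes K C) (hC_int : PowerIntegralDiverges K C m) :
    -- the functionals and their normalizations are well defined
    (∀ T : ℝ, 0 < T →
      (∀ᵐ ω ∂P, IntegrableOn
        (fun p : EuclideanSpace ℝ (Fin d) × ℝ => G (Z p.1 p.2 ω)) (K ×ˢ Icc 0 T)) ∧
      MemLp (localFunctional K Z G T) 2 P) ∧
    (∀ᶠ T : ℝ in atTop, 0 < hermiteSigma K Z P m T) ∧
    -- the `L²` distance tends to zero
    Tendsto (fun T : ℝ => eLpNorm (fun ω => normalizedFunctional K Z P G m T ω -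
      normalizedHermiteFunctional K Z P G m T ω) 2 P) atTop (𝓝 0) ∧
    -- the limiting distributions coincide: if one exists, so does the other, with the same law
    (∀ (ν : Measure ℝ) [IsProbabilityMeasure ν],
      TendstoInDistribution (normalizedFunctional K Z P G m) atTop (id : ℝ → ℝ)
        (fun _ : ℝ => P) ν ↔
      TendstoInDistribution (normalizedHermiteFunctional K Z P G m) atTop (id : ℝ → ℝ)
        (fun _ : ℝ => P) ν) := by
  have hK0 : volume K ≠ 0 := (Measure.measure_pos_of_nonempty_interior volume hK_interior).ne'
  have hpos : ∀ᶠ T : ℝ in atTop, 0 ≤ T ∧ 0 < covariancePowerIntegral K C m T := by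
    filter_upwards [(tendsto_covariancePowerIntegral_div hd hK_compact hK0 hZ
      hC_int).eventually_gt_atTop 0, eventually_gt_atTop 0] with T h hT
    exact ⟨hT.le, (div_pos_iff_of_pos_right hT).mp h⟩
  have hlim : Tendsto (fun T : ℝ => eLpNorm (fun ω => normalizedFunctional K Z P G m T ω -
      normalizedHermiteFunctional K Z P G m T ω) 2 P) atTop (𝓝 0) := by
    have h := (tendsto_covariancePowerIntegral_succ_div hd hK_compact hK0 hZ hC_sup
      hC_int).const_mul ((m ! : ℝ) * (∫ ξ, hermiteRemainder G m ξ ^ 2 ∂(gaussianReal 0 1)) /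
        hermiteCoeff G m ^ 2)
    have h' := ENNReal.tendsto_ofReal ((Real.continuous_sqrt.tendsto _).comp h)
    rw [mul_zero, Real.sqrt_zero, ENNReal.ofReal_zero] at h'
    refine tendsto_of_tendsto_of_tendsto_of_le_of_le' tendsto_const_nhds h'
      (Eventually.of_forall fun _ => zero_le) ?_
    filter_upwards [hpos] with T hT
    exact eLpNorm_normalizedFunctional_sub_le hd hK_compact hZ hG_measurable hG_memLp hG_rank
      hT.1 hT.2
  have hm1 := measurable_normalizedFunctional (P := P) hK_compact hZ hG_measurable m
  have hm2 := measurable_normalizedHermiteFunctional (P := P) hK_compact hZ G m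
  -- `L²` convergence of the difference gives convergence in measure, the input of Slutsky's
  -- theorem. Stated for arbitrary `X` and `Y`, it serves both directions of the equivalence.
  have hmeas : ∀ X Y : ℝ → Ω → ℝ, (∀ T, Measurable (X T)) → (∀ T, Measurable (Y T)) →
      Tendsto (fun T => eLpNorm (fun ω => Y T ω - X T ω) 2 P) atTop (𝓝 0) →
      TendstoInMeasure P (Y - X) atTop 0 := by
    intro X Y hX hY h
    refine tendstoInMeasure_of_tendsto_eLpNorm (p := 2) (by simp)
      (fun T => ((hY T).sub (hX T)).aestronglyMeasurable)
      aestronglyMeasurable_zero ?_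
    simp only [sub_zero]
    exact h
  refine ⟨fun T hT => ⟨ae_integrableOn_field hK_compact hZ hG_measurable hG_memLp T,
    (memLp_localFunctional_and_integral_sq hK_compact hZ hG_measurable hG_memLp hT.le).1⟩, ?_,
    hlim, fun ν _ => ⟨fun h => ?_, fun h => ?_⟩⟩
  · filter_upwards [hpos] with T hT
    have hmf : (0 : ℝ) < m ! := by exact_mod_cast m.factorial_pos
    rw [hermiteSigma_eq hK_compact hZ m hT.1]
    exact Real.sqrt_pos.mpr (mul_pos hmf hT.2)
  · refine tendstoInDistribution_of_tendstoInMeasure_sub _ _ h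
      (hmeas _ _ hm1 hm2 ?_) fun T => (hm2 T).aemeasurable
    refine hlim.congr fun T => ?_
    rw [← eLpNorm_neg]
    congr 1
    ext ω
    simp
  · exact tendstoInDistribution_of_tendstoInMeasure_sub _ _ h
      (hmeas _ _ hm2 hm1 hlim) fun T => (hm1 T).aemeasurable
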